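/- Let $k$ be an arbitrary field. Let $p,q$ be two relatively prime positive integers and let $\{F_m\}_{m\in\mathbb N}$ be the $(p,q)$-Fibonacci sequence, defined by $F_0=0$, $F_1=1$ and $F_{m+2}=p\,F_{m+1}+q\,F_m$ for every $m\ge 0$. Let $h,a,d,n$ be positive integers with $n\ge 3$, and set $d_1:=F_a$ and $d_i:=F_{ha+(i-1)d}$ for all $i\in\{2,\ldots,n\}$. Let $I_{\mathcal A}$ be the toric ideal of $\mathcal A=\{d_1,\ldots,d_n\}$, i.e. the kernel of the homomorphism of $k$-algebras $k[x_1,\ldots,x_n]\to k[t]$, $x_i\mapsto t^{d_i}$. The ideal $I_{\mathcal A}$ is called a complete intersection if its minimal number of generators equals its height. Then $I_{\mathcal A}$ is a complete intersection if and only if at least one of the following holds: (a) $d$ is odd; (b) $d\ge a$; (c) $a=2d$; (d) $\gcd\{a,d\}=a-d$ and $a$ is odd; (e) $n=3$ and $2d\mid a$. -/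

import Mathlib

/-- The `(p, q)`-Fibonacci sequence: `F 0 = 0`, `F 1 = 1`, `F (n + 2) = p * F (n + 1) + q * F n`. -/
def pqFib (p q : ℕ) : ℕ → ℕ
  | 0 => 0
  | 1 => 1
  | n + 2 => p * pqFib p q (n + 1) + q * pqFib p q n

/-- The toric ideal of the family `D = (d₁, …, dₙ)`: the kernel of the `k`-algebra homomorphism
`k[x₁, …, xₙ] → k[t]` that sends `xᵢ` to `t ^ dᵢ`. -/
noncomputable def toricIdeal (k : Type*) [Field k] {n : ℕ} (D : Fin n → ℕ) :
    Ideal (MvPolynomial (Fin n) k) :=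
  RingHom.ker (MvPolynomial.aeval fun i => (Polynomial.X : Polynomial k) ^ D i)

/-- An ideal of a Noetherian ring is a complete intersection if its minimal number of generators
is equal to its height. -/
def IsCompleteIntersectionIdeal {R : Type*} [CommRing R] [IsNoetherianRing R]
    (I : Ideal R) : Prop :=
  (Submodule.spanFinrank I : ℕ∞) = I.height

/-- The family `d₁ = F_a`, `dᵢ = F_{h a + (i - 1) d}` for `2 ≤ i ≤ n`. The index `i : Fin n` starts
at `0`, so it stands for the one-based index `i + 1`. -/
def fibFamily (p q n h a d : ℕ) (i : Fin n) : ℕ :=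
  if (i : ℕ) = 0 then pqFib p q a else pqFib p q (h * a + (i : ℕ) * d)

/-! Indices start at 0, as in `Fin n`. The toric ideal I has height n - 1 (`height_toricIdeal`), so
the question is whether n - 1 elements generate it. Put L = `pqLucas p q d`. Everything rests on L
F_{m+d} = F_{m+2d} + (-q)^d F_m and on Vajda's identity, whose signs produce the parity conditions.

Sufficiency. Under (a)-(d) every D i with i ≥ 2 lies in the semigroup generated by D 0 and D 1: for
odd d by the recurrence, otherwise because D i ≥ lcm(D 0, D 1) or D 0 ∣ D i
(`exists_pqFib_combination`). Eliminating these x_i leaves one binomial in x_0, x_1. Under (e) with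
d even, one binomial in x_0, x_2 and one of the form x_1^L - x_0^v x_2 generate.

Necessity. Let 𝔪 be the ideal of the origin. The coefficient at a monomial sharing no variable with
the others of its degree is a functional on I/𝔪I. So n such monomials, occurring in suitably
distinct binomials, force n generators (`le_spanFinrank_toricIdeal`). For n - 1 of them take the
least powers of x_1, …, x_{n-1} having the degree of a monomial in the other variables; for even d
their degrees are distinct (`critical_mul_ne`). The last is the analogous power of x_0, unless d ∣ a
and n ≥ 4, when it is a monomial in x_1 and x_2 (`exponents_eq_of_pqFib_combination_eq`). -/

/-! ### Identities and divisibility for (p, q)-Fibonacci numbers. -/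

section PqFib

variable {p q : ℕ}

theorem pqFib_add_two (p q n : ℕ) :
    pqFib p q (n + 2) = p * pqFib p q (n + 1) + q * pqFib p q n := rfl

theorem pqFib_add (p q m n : ℕ) :
    pqFib p q (m + n + 1) =
      pqFib p q (m + 1) * pqFib p q (n + 1) + q * (pqFib p q m * pqFib p q n) := by
  induction n generalizing m with
  | zero => simp [pqFib]
  | succ n ih =>
    have h := ih (m + 1)
    rw [show m + (n + 1) + 1 = m + 1 + n + 1 by ring, h, pqFib_add_two, pqFib_add_two]
    ring

theorem pqFib_pos (hp : 0 < p) {n : ℕ} (hn : 0 < n) : 0 < pqFib p q n := by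
  induction n using Nat.twoStepInduction with
  | zero => omega
  | one => simp [pqFib]
  | more n _ ih =>
    rw [pqFib_add_two]
    have := ih (by omega)
    positivity

theorem pqFib_le_succ (hp : 0 < p) (n : ℕ) : pqFib p q n ≤ pqFib p q (n + 1) := by
  cases n with
  | zero => simp [pqFib]
  | succ n =>
    rw [pqFib_add_two]
    nlinarith [Nat.zero_le (q * pqFib p q n), Nat.zero_le (pqFib p q (n + 1))]

theorem pqFib_mono (hp : 0 < p) : Monotone (pqFib p q) :=
  monotone_nat_of_le_succ (pqFib_le_succ hp)

theorem pqFib_lt_succ (hp : 0 < p) (hq : 0 < q) {n : ℕ} (hn : 2 ≤ n) :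
    pqFib p q n < pqFib p q (n + 1) := by
  obtain ⟨n, rfl⟩ : ∃ m, n = m + 1 := ⟨n - 1, by omega⟩
  rw [pqFib_add_two]
  have h1 : 0 < q * pqFib p q n := Nat.mul_pos hq (pqFib_pos hp (by omega))
  have h2 : pqFib p q (n + 1) ≤ p * pqFib p q (n + 1) := Nat.le_mul_of_pos_left _ hp
  omega

theorem pqFib_lt_of_lt (hp : 0 < p) (hq : 0 < q) {m n : ℕ} (hmn : m < n) (hn : 3 ≤ n) :
    pqFib p q m < pqFib p q n := by
  obtain ⟨n, rfl⟩ : ∃ l, n = l + 1 := ⟨n - 1, by omega⟩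
  exact (pqFib_mono hp (by omega)).trans_lt (pqFib_lt_succ hp hq (by omega))

theorem two_mul_pqFib_le (hp : 0 < p) (hq : 0 < q) (n : ℕ) :
    2 * pqFib p q n ≤ pqFib p q (n + 2) := by
  have h1 := Nat.le_mul_of_pos_left (pqFib p q (n + 1)) hp
  have h2 := Nat.le_mul_of_pos_left (pqFib p q n) hq
  have h3 := pqFib_le_succ (q := q) hp n
  rw [pqFib_add_two]
  omega

theorem two_mul_pqFib_lt (hp : 0 < p) (hq : 0 < q) {n : ℕ} (hn : 2 ≤ n) :
    2 * pqFib p q n < pqFib p q (n + 2) := by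
  have h1 := Nat.le_mul_of_pos_left (pqFib p q (n + 1)) hp
  have h2 := Nat.le_mul_of_pos_left (pqFib p q n) hq
  have h3 := pqFib_lt_succ hp hq hn
  rw [pqFib_add_two]
  omega

theorem pow_mul_pqFib_le (p q m n : ℕ) : q ^ m * pqFib p q n ≤ pqFib p q (n + 2 * m) := by
  induction m with
  | zero => simp
  | succ m ih =>
    rw [show n + 2 * (m + 1) = n + 2 * m + 2 by ring, pqFib_add_two, pow_succ]
    nlinarith [Nat.zero_le (p * pqFib p q (n + 2 * m + 1)), Nat.mul_le_mul_left q ih]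

theorem pqFib_mul_le (p q m n : ℕ) :
    pqFib p q (m + 1) * pqFib p q (n + 1) ≤ pqFib p q (m + n + 1) := by
  rw [pqFib_add]
  exact Nat.le_add_right _ _

theorem pqFib_mul_lt (hp : 0 < p) (hq : 0 < q) {m n : ℕ} (hm : 0 < m) (hn : 0 < n) :
    pqFib p q (m + 1) * pqFib p q (n + 1) < pqFib p q (m + n + 1) := by
  rw [pqFib_add]
  have := Nat.mul_pos hq (Nat.mul_pos (pqFib_pos (q := q) hp hm) (pqFib_pos (q := q) hp hn))
  omega

theorem pqFib_le_mul (hp : 0 < p) {m n : ℕ} (hm : 0 < m) :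
    pqFib p q (m + n) ≤ pqFib p q m * pqFib p q (n + 2) := by
  obtain ⟨m, rfl⟩ : ∃ l, m = l + 1 := ⟨m - 1, by omega⟩
  rw [show m + 1 + n = m + n + 1 by ring, pqFib_add, pqFib_add_two]
  have h1 := pqFib_le_succ (q := q) hp m
  have h2 := Nat.le_mul_of_pos_left (pqFib p q (n + 1)) hp
  have h3 := Nat.mul_le_mul_left (pqFib p q (m + 1)) h2
  have h4 := Nat.mul_le_mul_left q (Nat.mul_le_mul_right (pqFib p q n) h1)
  nlinarith

theorem pqFib_cassini (p q n : ℕ) :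
    (pqFib p q (n + 1) : ℤ) ^ 2 - pqFib p q n * pqFib p q (n + 2) = (-q) ^ n := by
  induction n with
  | zero => simp [pqFib]
  | succ n ih =>
    simp only [pow_succ (-(q : ℤ)), pqFib_add_two p q (n + 1), pqFib_add_two p q n] at ih ⊢
    push_cast at ih ⊢
    linear_combination (-q : ℤ) * ih

/-- Both sides obey the Fibonacci recurrence in `i` and in `j`. The parity of the base index `n`
fixes the sign of the right side. -/
theorem pqFib_vajda (p q n i j : ℕ) :
    (pqFib p q (n + i) : ℤ) * pqFib p q (n + j) - pqFib p q n * pqFib p q (n + i + j) =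
      (-q) ^ n * (pqFib p q i * pqFib p q j) := by
  have key (i : ℕ) : (pqFib p q (n + i) : ℤ) * pqFib p q (n + 1) -
      pqFib p q n * pqFib p q (n + i + 1) = (-q) ^ n * pqFib p q i := by
    induction i using Nat.twoStepInduction with
    | zero => simp [pqFib]
    | one => rw [← pqFib_cassini p q n]; simp [pqFib, sq]
    | more i h1 h2 =>
      simp only [← add_assoc, pqFib_add_two p q i, pqFib_add_two p q (n + i),
        pqFib_add_two p q (n + i + 1)] at h1 h2 ⊢
      push_cast at h1 h2 ⊢
      linear_combination (p : ℤ) * h2 + (q : ℤ) * h1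
  induction j using Nat.twoStepInduction with
  | zero => simp [pqFib]; ring
  | one => rw [key]; simp [pqFib]
  | more j h1 h2 =>
    simp only [← add_assoc, pqFib_add_two p q j, pqFib_add_two p q (n + j),
      pqFib_add_two p q (n + i + j)] at h1 h2 ⊢
    push_cast
    linear_combination (p : ℤ) * h2 + (q : ℤ) * h1

theorem coprime_pqFib_right (hpq : p.Coprime q) (n : ℕ) : (pqFib p q (n + 1)).Coprime q := by
  induction n with
  | zero => simp [pqFib]
  | succ n ih =>
    rw [pqFib_add_two, Nat.coprime_add_mul_left_left]
    exact hpq.mul_left ih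

theorem coprime_pqFib_succ (hpq : p.Coprime q) (n : ℕ) :
    (pqFib p q n).Coprime (pqFib p q (n + 1)) := by
  induction n with
  | zero => simp [pqFib]
  | succ n ih =>
    rw [pqFib_add_two, Nat.coprime_mul_right_add_right]
    exact (coprime_pqFib_right hpq n).mul_right ih.symm

theorem gcd_pqFib_add_self (hpq : p.Coprime q) (m n : ℕ) :
    (pqFib p q m).gcd (pqFib p q (n + m)) = (pqFib p q m).gcd (pqFib p q n) := by
  cases m with
  | zero => simp
  | succ m =>
    rw [← add_assoc, add_comm n m, pqFib_add, Nat.gcd_mul_left_add_right, ← mul_assoc]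
    exact Nat.Coprime.gcd_mul_left_cancel_right _
      ((coprime_pqFib_right hpq m).mul_right (coprime_pqFib_succ hpq m).symm).symm

theorem gcd_pqFib_add_mul_self (hpq : p.Coprime q) (m n k : ℕ) :
    (pqFib p q m).gcd (pqFib p q (n + k * m)) = (pqFib p q m).gcd (pqFib p q n) := by
  induction k with
  | zero => simp
  | succ k ih => rw [← ih, add_mul, ← add_assoc, one_mul, gcd_pqFib_add_self hpq]

/-- The Euclidean algorithm on indices lifts, because F_{m+1} is coprime to both q and F_m. -/
theorem pqFib_gcd (hpq : p.Coprime q) (m n : ℕ) :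
    (pqFib p q m).gcd (pqFib p q n) = pqFib p q (m.gcd n) := by
  induction m, n using Nat.gcd.induction with
  | H0 => simp [pqFib]
  | H1 m n _ h =>
    rw [← Nat.gcd_rec m n] at h
    conv_lhs => rw [← Nat.mod_add_div' n m]
    rw [gcd_pqFib_add_mul_self hpq m (n % m) (n / m), Nat.gcd_comm (pqFib p q m), h]

theorem pqFib_dvd (hpq : p.Coprime q) {m n : ℕ} (h : m ∣ n) : pqFib p q m ∣ pqFib p q n := by
  rw [← Nat.gcd_eq_left_iff_dvd, pqFib_gcd hpq, Nat.gcd_eq_left h]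

/-- The companion Lucas number `F (d + 1) + q * F (d - 1)`, for positive `d`. -/
def pqLucas (p q d : ℕ) : ℕ := pqFib p q (d + 1) + q * pqFib p q (d - 1)

theorem pqFib_two_mul (p q d : ℕ) : pqFib p q (2 * d) = pqLucas p q d * pqFib p q d := by
  cases d with
  | zero => simp [pqFib]
  | succ d =>
    rw [show 2 * (d + 1) = d + 1 + d + 1 by ring, pqFib_add, pqLucas, Nat.add_sub_cancel]
    ring

/-- The recurrence along a progression of step `d`. For odd `d` it expresses F_{m+2d} with
nonnegative coefficients; for even `d` it is a relation with a power of the middle variable alone on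
one side. -/
theorem pqLucas_mul_pqFib (p q m : ℕ) {d : ℕ} (hd : 0 < d) :
    (pqLucas p q d : ℤ) * pqFib p q (m + d) = pqFib p q (m + 2 * d) + (-q) ^ d * pqFib p q m := by
  obtain ⟨d, rfl⟩ : ∃ l, d = l + 1 := ⟨d - 1, by omega⟩
  have h := pqFib_vajda p q d 1 m
  rw [show m + 2 * (d + 1) = (m + d + 1) + d + 1 by ring, pqFib_add p q (m + d + 1) d]
  rw [show d + 1 + m = m + d + 1 by ring, add_comm d m] at h
  simp only [pqLucas, Nat.add_sub_cancel, ← add_assoc, pow_succ, pqFib_add_two p q (m + d)] at h ⊢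
  simp only [pqFib] at h ⊢
  push_cast at h ⊢
  linear_combination (-q : ℤ) * h

theorem pqLucas_le {d : ℕ} (hd : 0 < d) : pqLucas p q d ≤ 2 * pqFib p q (d + 1) := by
  obtain ⟨d, rfl⟩ : ∃ l, d = l + 1 := ⟨d - 1, by omega⟩
  rw [pqLucas, Nat.add_sub_cancel, pqFib_add_two]
  omega

theorem coprime_pqLucas (hpq : p.Coprime q) (d : ℕ) : (pqLucas p q d).Coprime q := by
  rw [pqLucas, Nat.coprime_add_mul_left_left]
  exact coprime_pqFib_right hpq d

theorem three_le_pqLucas (hp : 0 < p) (hq : 0 < q) {d : ℕ} (hd : 2 ≤ d) : 3 ≤ pqLucas p q d := by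
  have h1 : pqFib p q 3 ≤ pqFib p q (d + 1) := pqFib_mono hp (by omega)
  have h2 : pqFib p q 1 ≤ pqFib p q (d - 1) := pqFib_mono hp (by omega)
  simp only [pqFib, mul_one, mul_zero, add_zero, pqLucas] at h1 h2 ⊢
  nlinarith

end PqFib

/-! ### Binomials in the toric ideal and a lower bound for its generators. -/

section ToricIdeal

open MvPolynomial

variable {k : Type*} [Field k] {n : ℕ}

/-- The degree of the monomial with exponent `m` in the grading in which `xᵢ` has degree `D i`. -/
def toricDeg (D : Fin n → ℕ) (m : Fin n →₀ ℕ) : ℕ := ∑ i, m i * D i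

theorem toricDeg_add (D : Fin n → ℕ) (m m' : Fin n →₀ ℕ) :
    toricDeg D (m + m') = toricDeg D m + toricDeg D m' := by
  simp [toricDeg, add_mul, Finset.sum_add_distrib]

theorem toricDeg_single (D : Fin n → ℕ) (i : Fin n) (c : ℕ) :
    toricDeg D (Finsupp.single i c) = c * D i := by
  rw [toricDeg, Finset.sum_eq_single i] <;> simp +contextual [eq_comm]

theorem aeval_X_pow_monomial (D : Fin n → ℕ) (m : Fin n →₀ ℕ) (c : k) :
    aeval (fun i => (Polynomial.X : Polynomial k) ^ D i) (monomial m c) =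
      Polynomial.monomial (toricDeg D m) c := by
  rw [aeval_monomial, Finsupp.prod_fintype _ _ (by simp), ← Polynomial.C_mul_X_pow_eq_monomial,
    toricDeg, ← Finset.prod_pow_eq_pow_sum]
  simp [← pow_mul, mul_comm, Polynomial.C_eq_algebraMap]

theorem coeff_aeval_X_pow (D : Fin n → ℕ) (f : MvPolynomial (Fin n) k) (s : ℕ) :
    (aeval (fun i => (Polynomial.X : Polynomial k) ^ D i) f).coeff s =
      ∑ m ∈ f.support with toricDeg D m = s, f.coeff m := by
  conv_lhs => rw [f.as_sum, map_sum]
  simp [aeval_X_pow_monomial, Polynomial.finsetSum_coeff, Polynomial.coeff_monomial,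
    Finset.sum_filter]

theorem mem_toricIdeal {D : Fin n → ℕ} {f : MvPolynomial (Fin n) k} :
    f ∈ toricIdeal k D ↔ ∀ s, ∑ m ∈ f.support with toricDeg D m = s, f.coeff m = 0 := by
  rw [toricIdeal, RingHom.mem_ker, Polynomial.ext_iff]
  simp [coeff_aeval_X_pow]

theorem monomial_sub_monomial_mem_toricIdeal {D : Fin n → ℕ} {m m' : Fin n →₀ ℕ}
    (h : toricDeg D m = toricDeg D m') :
    monomial m 1 - monomial m' 1 ∈ toricIdeal k D := by
  rw [toricIdeal, RingHom.mem_ker, map_sub]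
  simp [aeval_X_pow_monomial, h]

/-- The toric ideal is generated by differences of monomials of equal degree. -/
theorem toricIdeal_le {D : Fin n → ℕ} {J : Ideal (MvPolynomial (Fin n) k)}
    (h : ∀ m m', toricDeg D m = toricDeg D m' →
      (monomial m 1 - monomial m' 1 : MvPolynomial (Fin n) k) ∈ J) :
    toricIdeal k D ≤ J := by
  classical
  intro f hf
  rw [mem_toricIdeal] at hf
  rw [f.as_sum, ← Finset.sum_fiberwise_of_maps_to
    (fun m hm => Finset.mem_image_of_mem (toricDeg D) hm)]
  refine Ideal.sum_mem _ fun s hs => ?_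
  obtain ⟨m₀, -, rfl⟩ := Finset.mem_image.1 hs
  have h0 : ∑ m ∈ f.support with toricDeg D m = toricDeg D m₀, monomial m₀ (f.coeff m) = 0 := by
    rw [← map_sum, hf, map_zero]
  rw [← sub_zero (Finset.sum _ _), ← h0, ← Finset.sum_sub_distrib]
  refine Ideal.sum_mem _ fun m hm => ?_
  have := J.mul_mem_left (C (f.coeff m)) (h m m₀ (Finset.mem_filter.1 hm).2)
  simpa [mul_sub, C_mul_monomial] using this

/-- To generate the toric ideal it suffices to bring every monomial to a normal form that is
determined by its degree. -/
theorem toricIdeal_le_of_normalForm {D : Fin n → ℕ} {J : Ideal (MvPolynomial (Fin n) k)}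
    (hJ : J ≤ toricIdeal k D) (N : Set (Fin n →₀ ℕ)) (hN : Set.InjOn (toricDeg D) N)
    (h : ∀ m, ∃ m' ∈ N, (monomial m 1 - monomial m' 1 : MvPolynomial (Fin n) k) ∈ J) :
    toricIdeal k D ≤ J := by
  have hdeg {m m' : Fin n →₀ ℕ}
      (hm : (monomial m 1 - monomial m' 1 : MvPolynomial (Fin n) k) ∈ J) :
      toricDeg D m = toricDeg D m' := by
    have := hJ hm
    rw [toricIdeal, RingHom.mem_ker, map_sub, sub_eq_zero] at this
    simp only [aeval_X_pow_monomial] at this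
    exact ((Polynomial.monomial_eq_monomial_iff.1 this).resolve_right (by simp)).1
  refine toricIdeal_le fun m m' hmm => ?_
  obtain ⟨l, hl, hml⟩ := h m
  obtain ⟨l', hl', hml'⟩ := h m'
  have : l = l' := hN hl hl' (by rw [← hdeg hml, hmm, hdeg hml'])
  subst this
  simpa using J.sub_mem hml hml'

/-- An exponent is isolated if its monomial shares no variable with any other monomial of the same
degree. -/
def IsIsolated (D : Fin n → ℕ) (M : Fin n →₀ ℕ) : Prop :=
  ∀ m, toricDeg D m = toricDeg D M → ∀ i, m i ≠ 0 → M i ≠ 0 → m = M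

/-- If x_i divides x^M = x_i x^{M'}, then `M'` is the only exponent of its degree, since any other,
times x_i, would share x_i with `M`. Elements of the ideal have coefficient 0 there. -/
theorem IsIsolated.coeff_mul_X {D : Fin n → ℕ} {M : Fin n →₀ ℕ} (hM : IsIsolated D M)
    {f : MvPolynomial (Fin n) k} (hf : f ∈ toricIdeal k D) (i : Fin n) :
    (f * X i).coeff M = 0 := by
  classical
  rw [coeff_mul_X']
  split_ifs with hi
  · have hMi : Finsupp.single i 1 ≤ M := by
      simpa [Nat.one_le_iff_ne_zero] using hi
    obtain ⟨M', rfl⟩ := exists_add_of_le hMi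
    rw [add_tsub_cancel_left]
    have h := mem_toricIdeal.1 hf (toricDeg D M')
    have huniq (m : Fin n →₀ ℕ) (hm : toricDeg D m = toricDeg D M') : m = M' := by
      have := hM (Finsupp.single i 1 + m) (by simp [toricDeg_add, hm]) i (by simp) (by simp)
      exact add_left_cancel this
    by_contra h0
    rw [Finset.sum_eq_single M'] at h
    · exact h0 h
    · intro m hm hne
      exact absurd (huniq m (Finset.mem_filter.1 hm).2) hne
    · intro hm
      simpa using hm
  · rfl

theorem IsIsolated.coeff_mul {D : Fin n → ℕ} {M : Fin n →₀ ℕ} (hM : IsIsolated D M)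
    {f : MvPolynomial (Fin n) k} (hf : f ∈ toricIdeal k D) (r : MvPolynomial (Fin n) k) :
    (r * f).coeff M = constantCoeff r * f.coeff M := by
  induction r using MvPolynomial.induction_on with
  | C a => simp [coeff_C_mul]
  | add r s hr hs => simp [add_mul, hr, hs]
  | mul_X r i _ =>
    rw [mul_right_comm, hM.coeff_mul_X (Ideal.mul_mem_left _ r hf)]
    simp

/-- The matrix of coefficients of the binomials at the `M i` is triangular with diagonal 1 once `i₀`
is singled out. Hence `M' j = M i₀` may be allowed for `j ≠ i₀`. -/
theorem le_spanFinrank_toricIdeal {D : Fin n → ℕ} (M M' : Fin n → (Fin n →₀ ℕ)) (i₀ : Fin n)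
    (hdeg : ∀ j, toricDeg D (M j) = toricDeg D (M' j)) (hiso : ∀ j, IsIsolated D (M j))
    (hinj : Function.Injective M) (hM' : ∀ i j, i ≠ i₀ → M' j ≠ M i) (h₀ : M' i₀ ≠ M i₀) :
    n ≤ (toricIdeal k D).spanFinrank := by
  classical
  let Λ : MvPolynomial (Fin n) k →ₗ[k] (Fin n → k) := LinearMap.pi fun i => lcoeff k (M i)
  have hΛ (f : MvPolynomial (Fin n) k) (i : Fin n) : Λ f i = f.coeff (M i) := rfl
  obtain ⟨S, hcard, hS⟩ := (IsNoetherian.noetherian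
    (toricIdeal k D)).exists_span_finset_card_eq_spanFinrank
  have hSI {f} (hf : f ∈ Submodule.span (MvPolynomial (Fin n) k) (S : Set (MvPolynomial (Fin n) k))) :
      f ∈ toricIdeal k D := hS ▸ hf
  -- On the ideal, multiplication by `r` acts on these coefficients through its constant term, so
  -- module generators map to `k`-generators.
  have hspan : ∀ f ∈ toricIdeal k D, Λ f ∈ Submodule.span k ((S.image Λ : Finset _) : Set (Fin n → k)) := by
    intro f hf
    rw [← hS] at hf
    induction hf using Submodule.span_induction with
    | mem f hf => exact Submodule.subset_span (by simpa using ⟨f, hf, rfl⟩)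
    | zero => simp
    | add f g _ _ h1 h2 => rw [map_add]; exact add_mem h1 h2
    | smul r f hf h =>
      have : Λ (r • f) = constantCoeff r • Λ f := by
        ext i
        simp [hΛ, smul_eq_mul, (hiso i).coeff_mul (hSI hf) r]
      rw [this]
      exact Submodule.smul_mem _ _ h
  let B (j : Fin n) : MvPolynomial (Fin n) k := monomial (M j) 1 - monomial (M' j) 1
  have hB (j : Fin n) : B j ∈ toricIdeal k D := monomial_sub_monomial_mem_toricIdeal (hdeg j)
  have hΛB (i j : Fin n) (hi : i ≠ i₀) : Λ (B j) i = if j = i then 1 else 0 := by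
    simp [hΛ, B, coeff_monomial, hM' i j hi, hinj.eq_iff]
  have hind : LinearIndependent k fun j => Λ (B j) := by
    rw [Fintype.linearIndependent_iff]
    intro c hc
    have h1 (i : Fin n) (hi : i ≠ i₀) : c i = 0 := by
      have := congrFun hc i
      simpa [hΛB _ _ hi] using this
    have h2 := congrFun hc i₀
    rw [Finset.sum_eq_single i₀ (fun j _ hj => by simp [h1 j hj]) (by simp)] at h2
    have h3 : Λ (B i₀) i₀ = 1 := by simp [hΛ, B, coeff_monomial, h₀]
    intro i
    by_cases hi : i = i₀
    · subst hi
      simpa [h3] using h2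
    · exact h1 i hi
  have hle : Submodule.span k (Set.range fun j => Λ (B j)) ≤
      Submodule.span k ((S.image Λ : Finset _) : Set (Fin n → k)) := by
    rw [Submodule.span_le]
    rintro _ ⟨j, rfl⟩
    exact hspan _ (hB j)
  calc n = Module.finrank k (Submodule.span k (Set.range fun j => Λ (B j))) := by
        rw [finrank_span_eq_card hind, Fintype.card_fin]
    _ ≤ _ := Submodule.finrank_mono hle
    _ ≤ (S.image Λ).card := finrank_span_finset_le_card _
    _ ≤ S.card := Finset.card_image_le
    _ = _ := hcard

end ToricIdeal

/-! ### The height, from a chain of kernels. -/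

section Height

open MvPolynomial

variable (k : Type*) [Field k] {n : ℕ}

/-- The kernel of the map that sends `xᵢ` to `t ^ D i` for `i < j` and fixes the other variables. -/
noncomputable def partialToricIdeal (D : Fin n → ℕ) (j : ℕ) : Ideal (MvPolynomial (Fin n) k) :=
  RingHom.ker (aeval fun i : Fin n => if (i : ℕ) < j then (X none : MvPolynomial (Option (Fin n)) k) ^ D i
    else X (some i))

theorem partialToricIdeal_isPrime (D : Fin n → ℕ) (j : ℕ) :
    (partialToricIdeal k D j).IsPrime :=
  RingHom.ker_isPrime _

theorem partialToricIdeal_eq (D : Fin n → ℕ) :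
    partialToricIdeal k D n = toricIdeal k D := by
  have h : (aeval fun i : Fin n => if (i : ℕ) < n then
      (X none : MvPolynomial (Option (Fin n)) k) ^ D i else X (some i)) =
      (Polynomial.aeval (X none : MvPolynomial (Option (Fin n)) k)).comp
        (aeval fun i => (Polynomial.X : Polynomial k) ^ D i) := by
    ext i
    simp
  ext f
  rw [partialToricIdeal, toricIdeal, RingHom.mem_ker, RingHom.mem_ker, h, AlgHom.comp_apply]
  refine map_eq_zero_iff _ ?_
  exact transcendental_iff_injective.1 (transcendental_X k none)

theorem partialToricIdeal_lt {D : Fin n → ℕ} (hD : ∀ i, 0 < D i) {j : ℕ} (hj : 0 < j) (hjn : j < n) :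
    partialToricIdeal k D j < partialToricIdeal k D (j + 1) := by
  refine lt_of_le_of_ne ?_ ?_
  · have h : (aeval fun i : Fin n => if (i : ℕ) < j + 1 then
        (X none : MvPolynomial (Option (Fin n)) k) ^ D i else X (some i)) =
        (aeval fun o : Option (Fin n) => o.elim (X none) fun i => if (i : ℕ) = j then
          (X none : MvPolynomial (Option (Fin n)) k) ^ D i else X (some i)).comp
        (aeval fun i : Fin n => if (i : ℕ) < j then
          (X none : MvPolynomial (Option (Fin n)) k) ^ D i else X (some i)) := by
      ext1 i
      rcases lt_trichotomy (i : ℕ) j with hi | hi | hi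
      · simp [hi, hi.le]
      · simp [hi]
      · simp [hi.not_gt, hi.ne', hi.not_ge]
    intro f hf
    rw [partialToricIdeal, RingHom.mem_ker] at hf ⊢
    rw [h, AlgHom.comp_apply, hf, map_zero]
  · intro h
    let a : Fin n := ⟨0, by omega⟩
    let b : Fin n := ⟨j, hjn⟩
    have hmem : (X b ^ D a - X a ^ D b : MvPolynomial (Fin n) k) ∈ partialToricIdeal k D (j + 1) := by
      rw [partialToricIdeal, RingHom.mem_ker]
      simp [a, b, ← pow_mul, mul_comm]
    rw [← h, partialToricIdeal, RingHom.mem_ker] at hmem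
    -- Setting t = 0 and the free variables to 1 sends the image of the binomial to 1.
    have := congrArg (aeval fun o : Option (Fin n) => o.elim (0 : k) fun _ => 1) hmem
    simp [a, b, hj, ← pow_mul, (hD _).ne'] at this

/-- The partial kernels form a strict chain of primes, giving ≥. The ideal lies strictly below that
of the origin, whose height is at most the dimension n + 1, giving ≤. -/
theorem height_toricIdeal {D : Fin (n + 1) → ℕ} (hD : ∀ i, 0 < D i) :
    (toricIdeal k D).height = n := by
  have hprime := partialToricIdeal_isPrime k D
  refine le_antisymm ?_ ?_
  · let m : Ideal (MvPolynomial (Fin (n + 1)) k) := RingHom.ker (constantCoeff (R := k))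
    have hm : m.IsPrime := RingHom.ker_isPrime _
    have := hprime (n + 1)
    rw [partialToricIdeal_eq] at this
    have hlt : toricIdeal k D < m := by
      refine lt_of_le_of_ne (fun f hf => ?_) fun h => ?_
      · rw [RingHom.mem_ker, constantCoeff_eq]
        have h := mem_toricIdeal.1 hf 0
        have huniq (m : Fin (n + 1) →₀ ℕ) : toricDeg D m = 0 ↔ m = 0 := by
          simp [toricDeg, (hD _).ne', Finsupp.ext_iff]
        by_contra h0
        rw [Finset.sum_eq_single 0] at h
        · exact h0 h
        · intro m hm hne
          exact absurd ((huniq m).1 (Finset.mem_filter.1 hm).2) hne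
        · intro hm
          simpa [huniq] using hm
      · have hX : (X 0 : MvPolynomial (Fin (n + 1)) k) ∈ m := by
          rw [RingHom.mem_ker, constantCoeff_X]
        rw [← h, toricIdeal, RingHom.mem_ker] at hX
        simp at hX
    have h1 := Ideal.height_add_one_le_of_lt_of_isPrime hlt
    have h2 : m.height ≤ (n + 1 : ℕ) := by
      have h := Ideal.height_le_ringKrullDim_of_isPrime (I := m)
      rw [MvPolynomial.ringKrullDim_of_isNoetherianRing, ringKrullDim_eq_zero_of_field] at h
      rw [zero_add, Nat.card_fin] at h
      exact_mod_cast h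
    have h3 := h1.trans h2
    push_cast at h3
    exact (ENat.add_le_add_iff_right ENat.one_ne_top).1 h3
  · have h (j : ℕ) (hj : j ≤ n) : (j : ℕ∞) ≤ (partialToricIdeal k D (j + 1)).height := by
      induction j with
      | zero => simp
      | succ j ih =>
        have := Ideal.height_add_one_le_of_lt_of_isPrime
          (partialToricIdeal_lt k hD (j := j + 1) (by omega) (by omega))
        push_cast
        exact (add_le_add_left (ih (by omega)) 1).trans this
    rw [← partialToricIdeal_eq]
    exact h n le_rfl

end Height

/-! ### Explicit generating sets. -/

section Generators

open MvPolynomial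

variable (k : Type*) [Field k] {n : ℕ}

theorem monomial_one_eq_prod {σ : Type*} [Fintype σ] (m : σ →₀ ℕ) :
    (monomial m 1 : MvPolynomial σ k) = ∏ i, X i ^ m i := by
  rw [monomial_eq, Finsupp.prod_fintype _ _ (by simp), C_1, one_mul]

theorem spanFinrank_span_range_le {R : Type*} [CommRing R] (G : Fin n → R) :
    (Ideal.span (Set.range G)).spanFinrank ≤ n := by
  refine (Submodule.spanFinrank_span_le_ncard_of_finite (Set.finite_range G)).trans ?_
  rw [← Set.image_univ]
  refine (Set.ncard_image_le Set.finite_univ).trans ?_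
  simp

theorem toricIdeal_eq_of_normalForm {D : Fin n → ℕ} {J : Ideal (MvPolynomial (Fin n) k)}
    (hJ : J ≤ toricIdeal k D) (N : Set (Fin n →₀ ℕ)) (hN : Set.InjOn (toricDeg D) N)
    (h : ∀ m : Fin n →₀ ℕ, ∃ m' ∈ N, ∏ i, Ideal.Quotient.mk J (X i) ^ m i =
      ∏ i, Ideal.Quotient.mk J (X i) ^ m' i) :
    toricIdeal k D = J := by
  refine le_antisymm (toricIdeal_le_of_normalForm hJ N hN fun m => ?_) hJ
  obtain ⟨m', hm', h⟩ := h m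
  refine ⟨m', hm', ?_⟩
  rw [← Ideal.Quotient.eq, monomial_one_eq_prod, monomial_one_eq_prod]
  simpa using h

theorem eq_of_mul_modEq_of_lt {x y b b' : ℕ} (hx : 0 < x) (h : b * y ≡ b' * y [MOD x])
    (hb : b < x / x.gcd y) (hb' : b' < x / x.gcd y) : b = b' := by
  have h1 := Nat.ModEq.cancel_right_div_gcd hx h
  rw [Nat.ModEq, Nat.mod_eq_of_lt hb, Nat.mod_eq_of_lt hb'] at h1
  exact h1

/-- Eliminate x_i for i ≥ 2, then reduce the exponent of x_1 below D 0 / g. The degree modulo D 0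
determines that exponent. -/
theorem spanFinrank_toricIdeal_le_of_mem_closure {D : Fin (n + 2) → ℕ} (h₀ : 0 < D 0)
    (h : ∀ i : Fin n, ∃ a b, a * D 0 + b * D 1 = D i.succ.succ) :
    (toricIdeal k D).spanFinrank ≤ n + 1 := by
  choose α β hαβ using h
  set g := (D 0).gcd (D 1) with hg
  have hg0 : g ∣ D 0 := Nat.gcd_dvd_left _ _
  have hg1 : g ∣ D 1 := Nat.gcd_dvd_right _ _
  let G : Fin (n + 1) → MvPolynomial (Fin (n + 2)) k :=
    Fin.cons (X 1 ^ (D 0 / g) - X 0 ^ (D 1 / g))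
      fun i => X i.succ.succ - X 0 ^ α i * X 1 ^ β i
  let J := Ideal.span (Set.range G)
  have hJ : J ≤ toricIdeal k D := by
    rw [Ideal.span_le]
    rintro _ ⟨i, rfl⟩
    change _ ∈ toricIdeal k D
    rw [toricIdeal, RingHom.mem_ker]
    refine Fin.cases ?_ (fun i => ?_) i
    · simp only [G, Fin.cons_zero, map_sub, map_pow, aeval_X, ← pow_mul]
      rw [sub_eq_zero, ← Nat.mul_div_assoc _ hg0, ← Nat.mul_div_assoc _ hg1, mul_comm]
    · simp only [G, Fin.cons_succ, map_sub, map_mul, map_pow, aeval_X, ← pow_mul, ← pow_add]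
      rw [sub_eq_zero, ← hαβ, mul_comm, mul_comm (D 1)]
  have hGJ (i) : G i ∈ J := Ideal.subset_span ⟨i, rfl⟩
  suffices toricIdeal k D = J by rw [this]; exact spanFinrank_span_range_le G
  set x := Ideal.Quotient.mk J (X 0) with hx
  set y := Ideal.Quotient.mk J (X 1) with hy
  have hyx : y ^ (D 0 / g) = x ^ (D 1 / g) := by
    have := Ideal.Quotient.eq_zero_iff_mem.2 (hGJ 0)
    simpa [G, sub_eq_zero] using this
  have hz (i : Fin n) : Ideal.Quotient.mk J (X i.succ.succ) = x ^ α i * y ^ β i := by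
    have := Ideal.Quotient.eq_zero_iff_mem.2 (hGJ i.succ)
    simpa [G, sub_eq_zero] using this
  have hprod (m : Fin (n + 2) →₀ ℕ) : ∏ i, Ideal.Quotient.mk J (X i) ^ m i =
      x ^ (m 0 + ∑ i : Fin n, α i * m i.succ.succ) *
        y ^ (m 1 + ∑ i : Fin n, β i * m i.succ.succ) := by
    rw [Fin.prod_univ_succ, Fin.prod_univ_succ]
    simp only [hz, Fin.succ_zero_eq_one, ← hx, ← hy, mul_pow, ← pow_mul, Finset.prod_mul_distrib,
      Finset.prod_pow_eq_pow_sum, pow_add]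
    ring
  refine toricIdeal_eq_of_normalForm k hJ
    {m | m 1 < D 0 / g ∧ ∀ i : Fin n, m i.succ.succ = 0} ?_ fun m => ?_
  · rintro m ⟨hm1, hm2⟩ m' ⟨hm1', hm2'⟩ hmm
    simp only [toricDeg, Fin.sum_univ_succ, hm2, hm2', zero_mul, Finset.sum_const_zero, add_zero,
      Fin.succ_zero_eq_one] at hmm
    have h1 : m 1 = m' 1 := by
      refine eq_of_mul_modEq_of_lt h₀ ?_ hm1 hm1'
      have := congrArg (· % D 0) hmm
      simpa [Nat.ModEq] using this
    rw [h1] at hmm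
    have h0 : m 0 = m' 0 := Nat.eq_of_mul_eq_mul_right h₀ (by omega)
    ext i
    refine Fin.cases h0 (fun i => Fin.cases h1 (fun i => ?_) i) i
    rw [hm2, hm2']
  · have hc : 0 < D 0 / g := Nat.div_pos (Nat.le_of_dvd h₀ hg0) (Nat.gcd_pos_of_pos_left _ h₀)
    set a := m 0 + ∑ i : Fin n, α i * m i.succ.succ with ha
    set b := m 1 + ∑ i : Fin n, β i * m i.succ.succ with hb
    refine ⟨Finsupp.single 0 (a + D 1 / g * (b / (D 0 / g))) + Finsupp.single 1 (b % (D 0 / g)),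
      ⟨?_, fun i => ?_⟩, ?_⟩
    · simpa using Nat.mod_lt b hc
    · have h1 : (i.succ.succ : Fin (n + 2)) ≠ 1 := by
        rw [← Fin.succ_zero_eq_one]
        exact fun h => Fin.succ_ne_zero i (Fin.succ_injective _ h)
      simp [h1.symm]
    · have h1 (i : Fin n) : (i.succ.succ : Fin (n + 2)) ≠ 1 := by
        rw [← Fin.succ_zero_eq_one]
        exact fun h => Fin.succ_ne_zero i (Fin.succ_injective _ h)
      rw [hprod, hprod, ← ha, ← hb]
      simp only [Finsupp.add_apply, Finsupp.single_apply, (h1 _).symm,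
        (Fin.succ_ne_zero _).symm, if_true, if_false, zero_ne_one, one_ne_zero, add_zero, mul_zero,
        Finset.sum_const_zero, zero_add]
      rw [pow_add x a, pow_mul x (D 1 / g), ← hyx, mul_assoc, ← pow_mul, ← pow_add,
        Nat.div_add_mod]

/-- A gluing of {D 0, D 2} with {D 1}. In normal form the degree modulo e = gcd(D 0, D 2) determines
the exponent of x_1, and then modulo D 0 that of x_2. -/
theorem spanFinrank_toricIdeal_le_two {D : Fin 3 → ℕ} (h₀ : 0 < D 0) {P v : ℕ}
    (hP : P = (D 0).gcd (D 2) / ((D 0).gcd (D 2)).gcd (D 1)) (hv : P * D 1 = v * D 0 + D 2) :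
    (toricIdeal k D).spanFinrank ≤ 2 := by
  set e := (D 0).gcd (D 2) with he
  have he0 : e ∣ D 0 := Nat.gcd_dvd_left _ _
  have he2 : e ∣ D 2 := Nat.gcd_dvd_right _ _
  have hepos : 0 < e := Nat.gcd_pos_of_pos_left _ h₀
  have hPpos : 0 < P := by
    rw [hP]
    exact Nat.div_pos (Nat.le_of_dvd hepos (Nat.gcd_dvd_left _ _)) (Nat.gcd_pos_of_pos_left _ hepos)
  have hf : 0 < D 0 / e := Nat.div_pos (Nat.le_of_dvd h₀ he0) hepos
  let G : Fin 2 → MvPolynomial (Fin 3) k :=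
    ![X 2 ^ (D 0 / e) - X 0 ^ (D 2 / e), X 1 ^ P - X 0 ^ v * X 2]
  let J := Ideal.span (Set.range G)
  have hJ : J ≤ toricIdeal k D := by
    rw [Ideal.span_le]
    rintro _ ⟨i, rfl⟩
    change _ ∈ toricIdeal k D
    rw [toricIdeal, RingHom.mem_ker]
    fin_cases i
    · simp only [G, Fin.zero_eta, Matrix.cons_val_zero, map_sub, map_pow, aeval_X, ← pow_mul]
      rw [sub_eq_zero, ← Nat.mul_div_assoc _ he0, ← Nat.mul_div_assoc _ he2, mul_comm]
    · simp only [G, Fin.mk_one, Matrix.cons_val_one, Matrix.cons_val_zero, map_sub, map_mul,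
        map_pow, aeval_X, ← pow_mul, ← pow_add]
      rw [sub_eq_zero, mul_comm, hv, mul_comm v]
  have hGJ (i) : G i ∈ J := Ideal.subset_span ⟨i, rfl⟩
  suffices toricIdeal k D = J by rw [this]; exact spanFinrank_span_range_le G
  set x := Ideal.Quotient.mk J (X 0) with hx
  set y := Ideal.Quotient.mk J (X 1) with hy
  set z := Ideal.Quotient.mk J (X 2) with hz
  have hzx : z ^ (D 0 / e) = x ^ (D 2 / e) := by
    have := Ideal.Quotient.eq_zero_iff_mem.2 (hGJ 0)
    simpa [G, sub_eq_zero] using this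
  have hyz : y ^ P = x ^ v * z := by
    have := Ideal.Quotient.eq_zero_iff_mem.2 (hGJ 1)
    simpa [G, sub_eq_zero] using this
  refine toricIdeal_eq_of_normalForm k hJ {m | m 1 < P ∧ m 2 < D 0 / e} ?_ fun m => ?_
  · rintro m ⟨hm1, hm2⟩ m' ⟨hm1', hm2'⟩ hmm
    simp only [toricDeg, Fin.sum_univ_three] at hmm
    have h1 : m 1 = m' 1 := by
      rw [hP] at hm1 hm1'
      refine eq_of_mul_modEq_of_lt hepos ?_ hm1 hm1'
      have h := congrArg (fun t : ℕ => (t : ZMod e)) hmm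
      rw [← ZMod.natCast_eq_natCast_iff]
      push_cast at h ⊢
      simpa [(ZMod.natCast_eq_zero_iff _ _).2 he0, (ZMod.natCast_eq_zero_iff _ _).2 he2] using h
    rw [h1] at hmm
    have h2 : m 2 = m' 2 := by
      refine eq_of_mul_modEq_of_lt h₀ ?_ hm2 hm2'
      have h := congrArg (fun t : ℕ => (t : ZMod (D 0))) hmm
      rw [← ZMod.natCast_eq_natCast_iff]
      push_cast at h ⊢
      simpa using h
    rw [h2] at hmm
    have h0 : m 0 = m' 0 := Nat.eq_of_mul_eq_mul_right h₀ (by omega)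
    ext i
    fin_cases i <;> assumption
  -- Each replacement of y^P by x^v z adds one z, so `c` is the exponent of z to be reduced next.
  · let c := m 2 + m 1 / P
    refine ⟨Finsupp.single 0 (m 0 + v * (m 1 / P) + D 2 / e * (c / (D 0 / e))) +
      Finsupp.single 1 (m 1 % P) + Finsupp.single 2 (c % (D 0 / e)), ⟨?_, ?_⟩, ?_⟩
    · simpa using Nat.mod_lt _ hPpos
    · simpa using Nat.mod_lt _ hf
    · simp only [Fin.prod_univ_three, ← hx, ← hy, ← hz]
      simp
      have h1 : y ^ m 1 = (x ^ v * z) ^ (m 1 / P) * y ^ (m 1 % P) := by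
        rw [← hyz, ← pow_mul, ← pow_add, Nat.div_add_mod]
      have h2 : z ^ c = (x ^ (D 2 / e)) ^ (c / (D 0 / e)) * z ^ (c % (D 0 / e)) := by
        rw [← hzx, ← pow_mul, ← pow_add, Nat.div_add_mod]
      calc _ = x ^ (m 0 + v * (m 1 / P)) * y ^ (m 1 % P) * z ^ c := by rw [h1]; ring
        _ = _ := by rw [h2]; ring

theorem isCompleteIntersectionIdeal_toricIdeal_iff {D : Fin (n + 1) → ℕ} (hD : ∀ i, 0 < D i) :
    IsCompleteIntersectionIdeal (toricIdeal k D) ↔ (toricIdeal k D).spanFinrank ≤ n := by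
  have hh := height_toricIdeal k hD
  have hle : (toricIdeal k D).height ≤ (toricIdeal k D).spanFinrank := by
    refine Ideal.height_le_spanFinrank _ fun h => ?_
    rw [h, Ideal.height_top] at hh
    exact ENat.top_ne_natCast n hh
  rw [IsCompleteIntersectionIdeal, hh] at *
  rw [Nat.cast_inj]
  have : n ≤ (toricIdeal k D).spanFinrank := by exact_mod_cast hle
  omega

end Generators

/-! ### Inequalities behind both directions. -/

section PqFibInequalities

variable {p q : ℕ}

theorem pow_mul_pqFib_lt (hp : 0 < p) (hq : 0 < q) {m : ℕ} (hm : 0 < m) (n : ℕ) :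
    q ^ m * pqFib p q n < pqFib p q (n + 2 * m) := by
  obtain ⟨m, rfl⟩ : ∃ l, m = l + 1 := ⟨m - 1, by omega⟩
  have h1 := pow_mul_pqFib_le p q m (n + 2)
  have h2 : 0 < q ^ m * (p * pqFib p q (n + 1)) :=
    Nat.mul_pos (pow_pos hq m) (Nat.mul_pos hp (pqFib_pos hp (by omega)))
  rw [pqFib_add_two, mul_add] at h1
  rw [show n + 2 * (m + 1) = n + 2 + 2 * m by ring, pow_succ, mul_assoc]
  omega

theorem pqLucas_mul_pqFib_of_even (p q m : ℕ) {d : ℕ} (hd : 0 < d) (he : Even d) :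
    pqLucas p q d * pqFib p q (m + d) = pqFib p q (m + 2 * d) + q ^ d * pqFib p q m := by
  have h := pqLucas_mul_pqFib p q m hd
  rw [he.neg_pow] at h
  exact_mod_cast h

theorem pqFib_add_two_mul_of_odd (p q m : ℕ) {d : ℕ} (ho : Odd d) :
    pqFib p q (m + 2 * d) = pqLucas p q d * pqFib p q (m + d) + q ^ d * pqFib p q m := by
  have h := pqLucas_mul_pqFib p q m ho.pos
  rw [ho.neg_pow] at h
  zify
  linarith

theorem pqLucas_mul_pqFib_lt (hp : 0 < p) (hq : 0 < q) (m : ℕ) {d : ℕ} (hd : 0 < d)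
    (he : Even d) : pqLucas p q d * pqFib p q (m + d) < 2 * pqFib p q (m + 2 * d) := by
  have h1 := pqLucas_mul_pqFib_of_even p q m hd he
  have h2 := pow_mul_pqFib_lt hp hq hd m
  omega

/-- L² = (F_{d+1} - q F_{d-1})² + 4q F_{d-1} F_{d+1}, and Cassini bounds the last product below. -/
theorem four_mul_pow_le_pqLucas_sq (p q : ℕ) {d : ℕ} (hd : 0 < d) (he : Even d) :
    4 * q ^ d ≤ pqLucas p q d ^ 2 := by
  obtain ⟨d, rfl⟩ : ∃ l, d = l + 1 := ⟨d - 1, by omega⟩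
  have h := pqFib_cassini p q d
  have ho : Odd d := by simpa [Nat.even_add_one] using he
  rw [ho.neg_pow] at h
  rw [pqLucas, Nat.add_sub_cancel, pow_succ q]
  zify
  nlinarith [sq_nonneg ((pqFib p q (d + 2) : ℤ) - q * pqFib p q d),
    mul_nonneg (Nat.cast_nonneg q : (0 : ℤ) ≤ q) (sq_nonneg (pqFib p q (d + 1) : ℤ))]

theorem gcd_pqFib_mul_add (hpq : p.Coprime q) (h a m : ℕ) :
    (pqFib p q a).gcd (pqFib p q (h * a + m)) = pqFib p q (a.gcd m) := by
  rw [add_comm, gcd_pqFib_add_mul_self hpq, pqFib_gcd hpq]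

/-- Let g = gcd(a, d). If g + d = a, then g is even and Vajda gives F_a = L F_g + q^g F_{d-g}.
Otherwise d + g + 2 ≤ a, and L F_g ≤ 2 F_{d+g} < F_{d+g+2}. -/
theorem pqLucas_mul_lt (hp : 0 < p) (hq : 0 < q) {a d : ℕ} (hd : 0 < d)
    (he : Even d) (hda : d < a) (h2 : a ≠ 2 * d) (hgcd : ¬ (a.gcd d + d = a ∧ Odd a)) :
    pqLucas p q d * pqFib p q (a.gcd d) < pqFib p q a := by
  set g := a.gcd d with hg
  have hga : g ∣ a := Nat.gcd_dvd_left _ _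
  have hgd : g ∣ d := Nat.gcd_dvd_right _ _
  have hg0 : 0 < g := Nat.gcd_pos_of_pos_right _ hd
  have hgle : g ≤ d := Nat.le_of_dvd hd hgd
  by_cases hag : g + d = a
  · have hev : Even g := by
      by_contra ho
      rw [Nat.not_even_iff_odd] at ho
      exact hgcd ⟨hag, hag ▸ ho.add_even he⟩
    have hlt : g < d := by omega
    have hv := pqFib_vajda p q g (d - g) d
    rw [hev.neg_pow, show g + (d - g) = d by omega, ← two_mul, pqFib_two_mul, hag] at hv
    have hpos : 0 < q ^ g * pqFib p q (d - g) :=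
      Nat.mul_pos (pow_pos hq g) (pqFib_pos hp (by omega))
    have hdpos : 0 < pqFib p q d := pqFib_pos hp hd
    have : pqFib p q a = pqLucas p q d * pqFib p q g + q ^ g * pqFib p q (d - g) := by
      refine Nat.eq_of_mul_eq_mul_left hdpos ?_
      zify
      push_cast at hv
      linear_combination hv
    omega
  · have hle : d + g + 2 ≤ a := by
      obtain ⟨s, hs⟩ := hga
      obtain ⟨t, ht⟩ := hgd
      have hst : t + 2 ≤ s := by
        have h1 : t < s := by
          by_contra hcon
          have := Nat.mul_le_mul_left g (not_lt.1 hcon)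
          omega
        have h2 : s ≠ t + 1 := by
          rintro rfl
          apply hag
          rw [hs]
          conv_lhs => rw [ht]
          ring
        omega
      have hmul := Nat.mul_le_mul_left g hst
      rw [mul_add] at hmul
      rcases Nat.lt_or_ge 1 g with h1 | h1
      · omega
      · have h1 : g = 1 := by omega
        have ha : ¬ Even a := fun hev => by
          have h := Nat.dvd_gcd hev.two_dvd he.two_dvd
          rw [← hg, h1] at h
          omega
        have h4 : a ≠ d + 2 := fun h => ha (h ▸ he.add even_two)
        rw [h1] at hmul hs ht
        omega
    have h1 := Nat.mul_le_mul_right (pqFib p q g) (pqLucas_le (p := p) (q := q) hd)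
    have h3 : pqFib p q (d + 1) * pqFib p q g ≤ pqFib p q (d + g) := by
      obtain ⟨l, hl⟩ : ∃ l, g = l + 1 := ⟨g - 1, by omega⟩
      rw [hl]
      exact pqFib_mul_le p q d l
    have h4 := two_mul_pqFib_lt hp hq (n := d + g) (by omega)
    have h5 : pqFib p q (d + g + 2) ≤ pqFib p q a := pqFib_mono hp hle
    nlinarith

theorem pqFib_mul_lt_mul (hp : 0 < p) (hq : 0 < q) {g e m : ℕ} (hg : 0 < g) (he : 2 ≤ m) {r : ℕ}
    (hr : e + 1 ≤ r) :
    pqFib p q (g + e) * pqFib p q m < pqFib p q g * pqFib p q (m + r) := by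
  obtain ⟨m, rfl⟩ : ∃ l, m = l + 1 := ⟨m - 1, by omega⟩
  have h1 := pqFib_le_mul (q := q) hp (n := e) hg
  have h2 := pqFib_mul_lt hp hq (m := e + 1) (n := m) (by omega) (by omega)
  have h3 : pqFib p q (e + 1 + m + 1) ≤ pqFib p q (m + 1 + r) := pqFib_mono hp (by omega)
  calc _ ≤ pqFib p q g * (pqFib p q (e + 2) * pqFib p q (m + 1)) := by
        rw [← mul_assoc]; exact Nat.mul_le_mul_right _ h1
    _ < _ := Nat.mul_lt_mul_of_pos_left (h2.trans_le h3) (pqFib_pos hp hg)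

/-- Sylvester's bound: every multiple of the gcd that is at least the lcm is representable. -/
theorem exists_add_mul_eq_of_mul_le {x y N : ℕ} (hx : 0 < x) (hdvd : x.gcd y ∣ N)
    (h : x * y ≤ N * x.gcd y) : ∃ a b, a * x + b * y = N := by
  have hg : 0 < x.gcd y := Nat.gcd_pos_of_pos_left _ hx
  obtain ⟨g, x', y', hg', hco, hx', hy'⟩ := Nat.exists_coprime' (m := x) (n := y) hg
  have hgcd : x.gcd y = g := by rw [hx', hy', Nat.gcd_mul_right, hco.gcd_eq_one, one_mul]
  rw [hgcd] at h hdvd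
  obtain ⟨N', rfl⟩ := hdvd
  obtain ⟨a, b, hab⟩ := Nat.exists_add_mul_eq_of_gcd_dvd_of_mul_pred_le x' y' N'
    (by rw [hco.gcd_eq_one]; exact one_dvd _) (by
      refine (Nat.mul_le_mul (Nat.pred_le _) (Nat.pred_le _)).trans ?_
      subst hx' hy'
      exact Nat.le_of_mul_le_mul_right (by nlinarith) (Nat.mul_pos hg' hg'))
  exact ⟨a, b, by rw [hx', hy', ← hab]; ring⟩

theorem exists_pqFib_combination (hp : 0 < p) (hq : 0 < q) (hpq : p.Coprime q) {h a d : ℕ}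
    (hh : 0 < h) (ha : 0 < a) (hd : 0 < d)
    (H : Odd d ∨ a ≤ d ∨ a = 2 * d ∨ (a.gcd d + d = a ∧ Odd a)) {i : ℕ} (hi : 2 ≤ i) :
    ∃ α β, α * pqFib p q a + β * pqFib p q (h * a + 1 * d) = pqFib p q (h * a + i * d) := by
  have hgcd : (pqFib p q a).gcd (pqFib p q (h * a + 1 * d)) = pqFib p q (a.gcd d) := by
    rw [gcd_pqFib_mul_add hpq, one_mul]
  have hdvd : pqFib p q (a.gcd d) ∣ pqFib p q (h * a + i * d) :=
    pqFib_dvd hpq (dvd_add ((Nat.gcd_dvd_left a d).mul_left h) ((Nat.gcd_dvd_right a d).mul_left i))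
  have key (hle : pqFib p q a * pqFib p q (h * a + d) ≤
      pqFib p q (h * a + i * d) * pqFib p q (a.gcd d)) :
      ∃ α β, α * pqFib p q a + β * pqFib p q (h * a + 1 * d) = pqFib p q (h * a + i * d) := by
    refine exists_add_mul_eq_of_mul_le (pqFib_pos hp ha) (by rwa [hgcd]) ?_
    rwa [hgcd, one_mul]
  have hhad : 0 < h * a := Nat.mul_pos hh ha
  rcases H with H | H | rfl | ⟨H, ho⟩
  · clear hi hdvd key
    induction i using Nat.twoStepInduction with
    | zero =>
      obtain ⟨c, hc⟩ := pqFib_dvd hpq (dvd_mul_left a h)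
      exact ⟨c, 0, by rw [zero_mul, zero_mul, add_zero, add_zero, hc, mul_comm]⟩
    | one => exact ⟨0, 1, by simp⟩
    | more i h1 h2 =>
      obtain ⟨α, β, h1⟩ := h1
      obtain ⟨α', β', h2⟩ := h2
      refine ⟨pqLucas p q d * α' + q ^ d * α, pqLucas p q d * β' + q ^ d * β, ?_⟩
      rw [show h * a + (i + 2) * d = h * a + i * d + 2 * d by ring,
        pqFib_add_two_mul_of_odd p q _ H, show h * a + i * d + d = h * a + (i + 1) * d by ring,
        ← h1, ← h2]
      ring
  · refine key ?_
    have h1 : pqFib p q a ≤ pqFib p q (d + 1) := pqFib_mono hp (by omega)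
    have h2 := pqFib_mul_le p q d (h * a + d - 1)
    rw [show h * a + d - 1 + 1 = h * a + d by omega] at h2
    have h3 : pqFib p q (d + (h * a + d - 1) + 1) ≤ pqFib p q (h * a + i * d) :=
      pqFib_mono hp (by nlinarith [Nat.sub_add_cancel (show 1 ≤ h * a + d by omega)])
    have h4 : 1 ≤ pqFib p q (a.gcd d) := pqFib_pos hp (Nat.gcd_pos_of_pos_left _ ha)
    calc _ ≤ _ := Nat.mul_le_mul_right _ h1
      _ ≤ _ := h2.trans h3
      _ ≤ _ := Nat.le_mul_of_pos_right _ h4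
  -- For i = 2, `a` divides h a + 2 d; the lcm bound is used only from i = 3 on.
  · rcases eq_or_lt_of_le hi with rfl | hi
    · obtain ⟨c, hc⟩ := pqFib_dvd (p := p) hpq (m := 2 * d) (n := h * (2 * d) + 2 * d)
        ⟨h + 1, by ring⟩
      exact ⟨c, 0, by rw [hc]; ring⟩
    · refine key ?_
      rw [Nat.gcd_mul_left_left, mul_comm _ (pqFib p q d), two_mul d]
      refine (pqFib_mul_lt_mul hp hq (r := d + 1) hd ?_ le_rfl).le.trans
        (Nat.mul_le_mul_left _ (pqFib_mono hp ?_))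
      · nlinarith
      · nlinarith
  · refine key ?_
    set g := a.gcd d with hg
    have hgo : Odd g := ho.of_dvd_nat (Nat.gcd_dvd_left _ _)
    obtain ⟨h, rfl⟩ : ∃ l, h = l + 1 := ⟨h - 1, by omega⟩
    -- The base index g is odd, so the right side is nonpositive. Here `h` is already one less than
    -- the original.
    have hv := pqFib_vajda p q g d (h * a + 2 * d)
    rw [hgo.neg_pow, show g + (h * a + 2 * d) = (h + 1) * a + d by rw [← H]; ring, H,
      show a + (h * a + 2 * d) = (h + 1) * a + 2 * d by ring] at hv
    have h1 : pqFib p q a * pqFib p q ((h + 1) * a + d) ≤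
        pqFib p q g * pqFib p q ((h + 1) * a + 2 * d) := by
      zify
      have : (0 : ℤ) ≤ q ^ g * (pqFib p q d * pqFib p q (h * a + 2 * d)) := by positivity
      linarith
    rw [mul_comm (pqFib p q g)] at h1
    exact h1.trans (Nat.mul_le_mul_right _ (pqFib_mono hp (by nlinarith)))

/-- Isolation of x_1^{uP-Q} x_2^{P-u}, with P = L, Q = q^d, X = F_{ha+d}, N = F_{ha}, A = F_a, R =
F_a / F_d; v, y, z, w are the exponents of x_0, …, x_3. Size forces t ≥ 0 in the divisibility. For t
= 0 the exponents are determined; for t > 0 the degree equation would give P ≤ 2u. -/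
theorem exponents_eq_of_degree_eq {P Q u X N A R y z w v : ℤ} (hP : 3 ≤ P) (hQ : 0 < Q)
    (hPQ : 4 * Q ≤ P ^ 2) (hu : (u - 1) * P < Q) (hu' : Q < u * P) (hN : 0 < N)
    (hX : P * N ≤ 2 * X) (hA : 0 < A) (hR : P ^ 2 - Q ≤ R)
    (hy : 0 ≤ y) (hz : 0 ≤ z) (hw : 0 ≤ w) (hv : 0 ≤ v)
    (heq : v * A + y * X + z * (P * X - Q * N) + w * ((P ^ 2 - Q) * X - P * Q * N) =
      (P ^ 2 - Q) * X - P * Q * N + u * Q * N)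
    (hdvd : R ∣ y + z * P + w * (P ^ 2 - Q) - (P ^ 2 - Q)) (hyz : 0 < y ∨ 0 < z) :
    v = 0 ∧ y = u * P - Q ∧ z = P - u ∧ w = 0 := by
  have hU : 0 < P ^ 2 - Q := by nlinarith
  have hu2 : 2 * u < P := by
    have : 4 * (u - 1) < P := by nlinarith
    omega
  obtain ⟨t, ht⟩ := hdvd
  have hK : -(P ^ 2 - Q) < R * t := by
    rw [← ht]
    rcases hyz with h | h <;> nlinarith [mul_nonneg hw hU.le, mul_nonneg hz (show 0 ≤ P by omega)]
  have ht0 : 0 ≤ t := by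
    by_contra h
    nlinarith
  rcases ht0.eq_or_lt with rfl | htpos
  · rw [mul_zero] at ht
    have hvA : v * A = Q * N * (z + w * P - (P - u)) := by
      linear_combination heq - X * ht
    have hw0 : w = 0 := by
      by_contra h
      have h1 : P ^ 2 - Q ≤ w * (P ^ 2 - Q) := le_mul_of_one_le_left hU.le (by omega)
      rcases hyz with h | h <;> nlinarith [mul_nonneg hz (show 0 ≤ P by omega)]
    subst hw0
    have hz1 : P - u ≤ z := by
      have h1 : 0 ≤ Q * N * (z + 0 * P - (P - u)) := hvA ▸ mul_nonneg hv hA.le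
      have h2 := nonneg_of_mul_nonneg_right h1 (mul_pos hQ hN)
      linarith
    have hz2 : u - 1 < P - z := by
      have : (u - 1) * P < (P - z) * P := by nlinarith
      exact lt_of_mul_lt_mul_right this (by omega)
    have hz3 : z = P - u := by omega
    subst hz3
    refine ⟨?_, by linear_combination ht, rfl, rfl⟩
    have h0 : v * A = 0 := by rw [hvA]; ring
    exact (mul_eq_zero.1 h0).resolve_right hA.ne'
  · exfalso
    set K := R * t with hKdef
    have hKU : P ^ 2 - Q ≤ K := by nlinarith
    have h1 : K * X ≤ Q * N * (z + w * P - P + u) := by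
      have : K * X = Q * N * (z + w * P - P + u) - v * A := by
        linear_combination heq - X * ht
      nlinarith [mul_nonneg hv hA.le]
    have h2 : (P ^ 2 - Q) * (z + w * P) ≤ P * (K + (P ^ 2 - Q)) := by
      have : K + (P ^ 2 - Q) = y + z * P + w * (P ^ 2 - Q) := by rw [← ht]; ring
      rw [this]
      nlinarith [mul_nonneg hy (show 0 ≤ P by omega), mul_nonneg hz hQ.le]
    have hQN : 0 < Q * N := mul_pos hQ hN
    have hKpos : 0 < K := by omega
    have hu0 : 0 < u := by
      by_contra h
      nlinarith
    have h3 : (P ^ 2 - Q) * (z + w * P - P + u) ≤ K * (P + u) := by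
      nlinarith [mul_le_mul_of_nonneg_left hKU hu0.le]
    have h4 : K * ((P ^ 2 - Q) * X) ≤ K * (Q * N * (P + u)) := by
      have h5 := mul_le_mul_of_nonneg_left h1 hU.le
      have h6 := mul_le_mul_of_nonneg_left h3 hQN.le
      linarith
    have h5 := le_of_mul_le_mul_left h4 hKpos
    have h6 : 3 * Q * (P * N) ≤ (P ^ 2 - Q) * (2 * X) :=
      mul_le_mul (by linarith) hX (mul_nonneg (by omega) hN.le) hU.le
    nlinarith [mul_lt_mul_of_pos_left hu2 hQN]

end PqFibInequalities

/-! ### Critical powers of the variables. -/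

section Critical

open MvPolynomial

variable {n : ℕ}

theorem toricDeg_eq_zero {D : Fin n → ℕ} (hD : ∀ i, 0 < D i) {m : Fin n →₀ ℕ} :
    toricDeg D m = 0 ↔ m = 0 := by
  simp [toricDeg, (hD _).ne', Finsupp.ext_iff]

/-- `c` is the least positive integer such that `c * D j` is the degree of a monomial in the
variables other than `xⱼ`. -/
def IsCritical (D : Fin n → ℕ) (j : Fin n) (c : ℕ) : Prop :=
  IsLeast {c | 0 < c ∧ ∃ m : Fin n →₀ ℕ, m j = 0 ∧ toricDeg D m = c * D j} c

theorem exists_isCritical {D : Fin n → ℕ} (hD : ∀ i, 0 < D i) {i j : Fin n} (hij : i ≠ j) :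
    ∃ c, IsCritical D j c := by
  classical
  have h : ∃ c, 0 < c ∧ ∃ m : Fin n →₀ ℕ, m j = 0 ∧ toricDeg D m = c * D j :=
    ⟨D i, hD i, Finsupp.single i (D j), by simp [hij], by rw [toricDeg_single, mul_comm]⟩
  exact ⟨Nat.find h, Nat.find_spec h, fun c hc => Nat.find_min' h hc⟩

/-- Cancelling x_j from another monomial of that degree would leave a smaller admissible power. -/
theorem IsCritical.isIsolated {D : Fin n → ℕ} (hD : ∀ i, 0 < D i) {j : Fin n} {c : ℕ}
    (hc : IsCritical D j c) : IsIsolated D (Finsupp.single j c) := by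
  classical
  intro m hm i hi hMi
  have hij : j = i := by
    by_contra h
    exact hMi (by simp [h])
  subst hij
  have hsplit := Finsupp.single_add_erase j m
  have hdeg : m j * D j + toricDeg D (m.erase j) = c * D j := by
    rw [← toricDeg_single, ← toricDeg_single, ← toricDeg_add, hsplit, hm]
  have hle : m j ≤ c := Nat.le_of_mul_le_mul_right (by omega) (hD j)
  rcases hle.eq_or_lt with h | h
  · rw [h] at hdeg
    have h0 : m.erase j = 0 := (toricDeg_eq_zero hD).1 (by omega)
    rw [← hsplit, h0, add_zero, h]
  · exfalso
    have := hc.2 (show c - m j ∈ _ from ⟨by omega, m.erase j, by simp, by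
      rw [Nat.sub_mul]; omega⟩)
    omega

theorem le_spanFinrank_toricIdeal_of_isCritical (k : Type*) [Field k] {D : Fin n → ℕ}
    (hD : ∀ i, 0 < D i) (i₀ : Fin n) {c : Fin n → ℕ} (hc : ∀ j, j ≠ i₀ → IsCritical D j (c j))
    (hne : ∀ i j, i ≠ i₀ → j ≠ i₀ → i ≠ j → c i * D i ≠ c j * D j) {M M' : Fin n →₀ ℕ}
    (hM : IsIsolated D M) (hMM' : toricDeg D M = toricDeg D M') (hMne : M' ≠ M)
    (hMc : ∀ j, j ≠ i₀ → M ≠ Finsupp.single j (c j))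
    (hMc' : ∀ j, j ≠ i₀ → M' ≠ Finsupp.single j (c j)) :
    n ≤ (toricIdeal k D).spanFinrank := by
  classical
  have hex (j : Fin n) : ∃ m, j ≠ i₀ → m j = 0 ∧ toricDeg D m = c j * D j := by
    by_cases hj : j = i₀
    · exact ⟨0, fun h => absurd hj h⟩
    · obtain ⟨m, hm⟩ := (hc j hj).1.2
      exact ⟨m, fun _ => hm⟩
  choose m hm using hex
  have hval (f : Fin n → Fin n →₀ ℕ) (N : Fin n →₀ ℕ) (j : Fin n) (hj : j ≠ i₀) :
      Function.update f i₀ N j = f j := Function.update_of_ne hj _ _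
  refine le_spanFinrank_toricIdeal (Function.update (fun j => Finsupp.single j (c j)) i₀ M)
    (Function.update m i₀ M') i₀ (fun j => ?_) (fun j => ?_) ?_ (fun i j hi => ?_) (by simpa)
  · by_cases hj : j = i₀
    · subst hj; simpa
    · rw [hval _ _ _ hj, hval _ _ _ hj, toricDeg_single, (hm j hj).2]
  · by_cases hj : j = i₀
    · subst hj; simpa
    · rw [hval _ _ _ hj]
      exact (hc j hj).isIsolated hD
  · intro i j hij
    by_cases hi : i = i₀ <;> by_cases hj : j = i₀
    · rw [hi, hj]
    · rw [hval _ _ _ hj, hi, Function.update_self] at hij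
      exact absurd hij (hMc j hj)
    · rw [hval _ _ _ hi, hj, Function.update_self] at hij
      exact absurd hij.symm (hMc i hi)
    · rw [hval _ _ _ hi, hval _ _ _ hj] at hij
      exact Finsupp.single_left_injective (hc i hi).1.1.ne' (by
        rcases Finsupp.single_eq_single_iff _ _ _ _ |>.1 hij with h | h
        · simpa using congrArg (fun t => Finsupp.single t (c i)) h.1
        · exact absurd h.1 (hc i hi).1.1.ne')
  · rw [hval _ _ _ hi]
    by_cases hj : j = i₀
    · rw [hj, Function.update_self]
      exact hMc' i hi
    · rw [hval _ _ _ hj]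
      intro h
      by_cases hij : i = j
      · subst hij
        have := (hm i hi).1
        rw [h, Finsupp.single_eq_same] at this
        exact (hc i hi).1.1.ne' this
      · have := (hm j hj).2
        rw [h, toricDeg_single] at this
        exact hne i j hi hj hij this

end Critical

/-! ### Critical degrees of the Fibonacci family. -/

section FibFamily

variable {p q : ℕ} {n h a d : ℕ}

theorem fibFamily_zero : fibFamily p q (n + 1) h a d 0 = pqFib p q a := rfl

theorem fibFamily_of_pos {i : Fin n} (hi : 0 < (i : ℕ)) :
    fibFamily p q n h a d i = pqFib p q (h * a + i * d) :=
  if_neg hi.ne'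

theorem fibFamily_pos (hp : 0 < p) (hh : 0 < h) (ha : 0 < a) (i : Fin n) :
    0 < fibFamily p q n h a d i := by
  have : 0 < h * a := Nat.mul_pos hh ha
  unfold fibFamily
  split_ifs <;> exact pqFib_pos hp (by omega)

theorem IsCritical.le_pqLucas (hp : 0 < p) (hpq : p.Coprime q)
    (hd : 0 < d) (he : Even d) {l : Fin n} {c : ℕ} (hl : 0 < (l : ℕ))
    (hln : (l : ℕ) + 1 < n) (hc : IsCritical (fibFamily p q n h a d) l c) :
    c ≤ pqLucas p q d := by
  have hP : 0 < pqLucas p q d := by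
    have := pqFib_pos (q := q) hp (n := d + 1) (by omega)
    rw [pqLucas]
    omega
  let l' : Fin n := ⟨l + 1, hln⟩
  let l'' : Fin n := ⟨l - 1, by omega⟩
  -- The recurrence calls for F_{ha} when l = 1, but the family has F_a there; F_a ∣ F_{ha} repairs
  -- this.
  obtain ⟨t, ht⟩ : ∃ t, t * fibFamily p q n h a d l'' =
      q ^ d * pqFib p q (h * a + (l - 1 : ℕ) * d) := by
    by_cases h1 : (l : ℕ) - 1 = 0
    · obtain ⟨s, hs⟩ := pqFib_dvd hpq (dvd_mul_left a h)
      refine ⟨q ^ d * s, ?_⟩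
      simp only [fibFamily, l'', h1, if_true, zero_mul, add_zero, hs]
      ring
    · exact ⟨q ^ d, by simp only [fibFamily, l'', h1, if_false]⟩
  refine hc.2 ⟨hP, Finsupp.single l' 1 + Finsupp.single l'' t, ?_, ?_⟩
  · have h1 : l' ≠ l := by simp [l', Fin.ext_iff]
    have h2 : l'' ≠ l := by simp only [l'', ne_eq, Fin.ext_iff]; omega
    simp [h1, h2]
  · have h3 := pqLucas_mul_pqFib_of_even p q (h * a + (l - 1 : ℕ) * d) hd he
    rw [toricDeg_add, toricDeg_single, toricDeg_single, ht, one_mul, fibFamily_of_pos hl,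
      fibFamily_of_pos (by simp [l'])]
    obtain ⟨s, hs⟩ : ∃ s, (l : ℕ) = s + 1 := ⟨l - 1, by omega⟩
    simp only [l', hs, Nat.add_sub_cancel] at h3 ⊢
    rw [show h * a + (s + 1) * d = h * a + s * d + d by ring, h3]
    congr 2
    ring

/-- The bound c ≤ L makes the left degree less than 2 D (l + 1). Equality thus forces j = l + 1 and
c' = 1, so D l would divide D (l + 1), against the gcd formula. -/
theorem critical_mul_ne_of_lt (hp : 0 < p) (hq : 0 < q) (hpq : p.Coprime q) (hh : 0 < h)
    (ha : 0 < a) (hd : 0 < d) (he : Even d) {l j : Fin n} (hl : 0 < (l : ℕ)) (hlj : (l : ℕ) < j)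
    {c c' : ℕ} (hc : IsCritical (fibFamily p q n h a d) l c) (hc' : 0 < c') :
    c * fibFamily p q n h a d l ≠ c' * fibFamily p q n h a d j := by
  intro heq
  have hhad : 0 < h * a := Nat.mul_pos hh ha
  have hd2 : 2 ≤ d := Nat.le_of_dvd hd he.two_dvd
  have hcP := hc.le_pqLucas hp hpq hd he hl (by omega)
  rw [fibFamily_of_pos hl, fibFamily_of_pos (hl.trans hlj)] at heq
  obtain ⟨s, hs⟩ : ∃ s, (l : ℕ) = s + 1 := ⟨l - 1, by omega⟩
  set m := h * a + s * d with hm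
  have hl' : h * a + l * d = m + d := by rw [hs, hm]; ring
  rw [hl'] at heq
  have h1 := pqLucas_mul_pqFib_lt hp hq m hd he
  have h2 := Nat.mul_le_mul_right (pqFib p q (m + d)) hcP
  have hjl : (j : ℕ) = s + 2 := by
    by_contra hne
    have hjm : m + 2 * d + 2 ≤ h * a + j * d := by
      have := Nat.mul_le_mul_right d (show s + 3 ≤ (j : ℕ) by omega)
      nlinarith
    have h3 := pqFib_mono (q := q) hp hjm
    have h4 := two_mul_pqFib_le hp hq (m + 2 * d)
    have h5 := Nat.le_mul_of_pos_left (pqFib p q (h * a + j * d)) hc'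
    omega
  have hj' : h * a + j * d = m + 2 * d := by rw [hjl, hm]; ring
  rw [hj'] at heq
  have hc1 : c' = 1 := by
    by_contra hne
    have h3 := Nat.mul_le_mul_right (pqFib p q (m + 2 * d)) (show 2 ≤ c' by omega)
    omega
  rw [hc1, one_mul] at heq
  have hdvd : pqFib p q (m + d) ∣ pqFib p q (m + 2 * d) := ⟨c, by rw [← heq, mul_comm]⟩
  have hg := Nat.gcd_eq_left hdvd
  rw [pqFib_gcd hpq, show m + 2 * d = d + (m + d) by ring, Nat.gcd_add_self_right] at hg
  have hmpos : 0 < m := by omega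
  have hle : (m + d).gcd d ≤ d := Nat.gcd_le_right _ hd
  have := pqFib_lt_of_lt hp hq (show (m + d).gcd d < m + d by omega) (by omega)
  omega

theorem critical_mul_ne (hp : 0 < p) (hq : 0 < q) (hpq : p.Coprime q) (hh : 0 < h)
    (ha : 0 < a) (hd : 0 < d) (he : Even d) {c : Fin n → ℕ}
    (hc : ∀ j : Fin n, 0 < (j : ℕ) → IsCritical (fibFamily p q n h a d) j (c j)) {i j : Fin n}
    (hi : 0 < (i : ℕ)) (hj : 0 < (j : ℕ)) (hij : i ≠ j) :
    c i * fibFamily p q n h a d i ≠ c j * fibFamily p q n h a d j := by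
  rcases lt_or_gt_of_ne (Fin.val_ne_of_ne hij) with hlt | hlt
  · exact critical_mul_ne_of_lt hp hq hpq hh ha hd he hi hlt (hc i hi) (hc j hj).1.1
  · exact (critical_mul_ne_of_lt hp hq hpq hh ha hd he hj hlt (hc j hj) (hc i hi).1.1).symm

theorem exists_isCritical_fibFamily (hp : 0 < p) (hh : 0 < h) (ha : 0 < a) (hn : 2 ≤ n) :
    ∃ c : Fin n → ℕ, ∀ j, IsCritical (fibFamily p q n h a d) j (c j) := by
  have (j : Fin n) : ∃ c, IsCritical (fibFamily p q n h a d) j c := by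
    have : Nontrivial (Fin n) := Fin.nontrivial_iff_two_le.2 hn
    obtain ⟨i, hi⟩ := exists_ne j
    exact exists_isCritical (fibFamily_pos hp hh ha) hi
  exact Classical.axiomOfChoice this

/-- No power of `x₁` of critical degree agrees with a critical power of another variable. -/
theorem le_spanFinrank_fibFamily_of_gcd_le (k : Type*) [Field k] (hp : 0 < p) (hq : 0 < q)
    (hpq : p.Coprime q) (hh : 0 < h) (ha : 0 < a) (hd : 0 < d) (he : Even d)
    (hlt : pqLucas p q d * pqFib p q (a.gcd d) < pqFib p q a)
    (hgcd : ∀ j, 2 ≤ j → j < n + 3 → a.gcd (j * d) + 1 ≤ a.gcd d + (j - 1) * d) :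
    n + 3 ≤ (toricIdeal k (fibFamily p q (n + 3) h a d)).spanFinrank := by
  obtain ⟨c, hc⟩ := exists_isCritical_fibFamily (q := q) (d := d) hp hh ha (show 2 ≤ n + 3 by omega)
  set D := fibFamily p q (n + 3) h a d with hDdef
  have hD : ∀ i, 0 < D i := fibFamily_pos hp hh ha
  have hpos {j : Fin (n + 3)} (hj : j ≠ 0) : 0 < (j : ℕ) :=
    Nat.pos_of_ne_zero fun h => hj (Fin.ext h)
  have hgpos (j : ℕ) : 0 < pqFib p q (a.gcd j) := pqFib_pos hp (Nat.gcd_pos_of_pos_left _ ha)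
  have hdvd (j : ℕ) : pqFib p q (a.gcd j) ∣ pqFib p q a := pqFib_dvd hpq (Nat.gcd_dvd_left _ _)
  have hD0 : D 0 = pqFib p q a := rfl
  have hDj {j : Fin (n + 3)} (hj : 0 < (j : ℕ)) : D j = pqFib p q (h * a + j * d) :=
    fibFamily_of_pos hj
  -- a common multiple `s * D 0 = t * D j` forces a large `t`
  have hmult {j : Fin (n + 3)} (hj : 0 < (j : ℕ)) {s t : ℕ} (ht : 0 < t)
      (hst : s * D 0 = t * D j) : pqFib p q a ≤ t * pqFib p q (a.gcd (j * d)) := by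
    have h1 : pqFib p q a ∣ t * pqFib p q (a.gcd (j * d)) := by
      rw [← gcd_pqFib_mul_add hpq h a, ← Nat.gcd_mul_left]
      exact Nat.dvd_gcd (dvd_mul_left _ _) ⟨s, by rw [← hDj hj, ← hst, hD0, mul_comm]⟩
    exact Nat.le_of_dvd (Nat.mul_pos ht (hgpos _)) h1
  obtain ⟨-, m, hm0, hm⟩ := (hc 0).1
  have hDnat : ∀ i j : Fin (n + 3), i ≠ 0 → j ≠ 0 → i ≠ j → c i * D i ≠ c j * D j :=
    fun i j hi hj hij => critical_mul_ne hp hq hpq hh ha hd he (fun j _ => hc j)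
      (hpos hi) (hpos hj) hij
  refine le_spanFinrank_toricIdeal_of_isCritical k hD 0 (M' := m) (fun j _ => hc j) hDnat
    ((hc 0).isIsolated hD) (by rw [toricDeg_single, hm]) ?_ (fun j hj hcon => ?_)
    (fun j hj hcon => ?_)
  · intro hcon
    rw [hcon, Finsupp.single_eq_same] at hm0
    exact (hc 0).1.1.ne' hm0
  · have := DFunLike.congr_fun hcon j
    rw [Finsupp.single_eq_same, Finsupp.single_eq_of_ne hj] at this
    exact (hc j).1.1.ne this
  · rw [hcon, toricDeg_single] at hm
    have h1 := hmult (hpos hj) (hc j).1.1 hm.symm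
    have hj1 := hpos hj
    rcases Nat.lt_or_ge 1 j with h2 | h2
    · -- compare with the least common multiple of `D 0` and `D 1`
      let i1 : Fin (n + 3) := ⟨1, by omega⟩
      obtain ⟨A, hA⟩ := hdvd d
      have hApos : 0 < A := by
        refine Nat.pos_of_ne_zero fun h0 => ?_
        rw [h0, mul_zero] at hA
        exact (pqFib_pos (q := q) hp ha).ne' hA
      obtain ⟨B, hB⟩ : pqFib p q (a.gcd d) ∣ D i1 := by
        rw [hDj (by simp [i1])]
        exact pqFib_dvd hpq (dvd_add ((Nat.gcd_dvd_left _ _).mul_left h)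
          ((Nat.gcd_dvd_right _ _).mul_left _))
      have hBpos : 0 < B := by
        refine Nat.pos_of_ne_zero fun h0 => ?_
        rw [h0, mul_zero] at hB
        exact (hD _).ne' hB
      have hc0 : c 0 ≤ B := by
        refine (hc 0).2 ⟨hBpos, Finsupp.single i1 A, ?_, ?_⟩
        · have : i1 ≠ 0 := by simp [i1]
          simp [this]
        · rw [toricDeg_single, hB, hD0, hA]
          ring
      have hDi1 : D i1 = pqFib p q (h * a + d) := by
        rw [hDj (by simp [i1])]
        simp [i1]
      set g := a.gcd d with hg
      have hgg : g ≤ a.gcd (j * d) := Nat.le_of_dvd (Nat.gcd_pos_of_pos_left _ ha)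
        (Nat.gcd_dvd_gcd_of_dvd_right _ (dvd_mul_left _ _))
      obtain ⟨e, hee⟩ := Nat.exists_eq_add_of_le hgg
      have hgj := hgcd j h2 j.2
      -- This says lcm(D 0, D 1) < lcm(D 0, D j). Minimality of `c 0` and the assumed equality give
      -- the opposite inequality.
      have hlt' := pqFib_mul_lt_mul (q := q) hp hq (g := g) (e := e) (m := h * a + d)
        (Nat.gcd_pos_of_pos_left _ ha) (by have := Nat.mul_pos hh ha; omega)
        (r := (j - 1) * d) (by omega)
      have hjd : h * a + d + ((j : ℕ) - 1) * d = h * a + j * d := by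
        obtain ⟨s, hs⟩ : ∃ s, (j : ℕ) = s + 1 := ⟨j - 1, by omega⟩
        rw [hs, Nat.add_sub_cancel]
        ring
      rw [← hee, hjd, ← hDj hj1, ← hDi1] at hlt'
      -- `c 0 * D 0 = c j * D j`
      have h3 : c 0 * D 0 * pqFib p q g ≤ D 0 * D i1 := by
        rw [hB]
        calc _ ≤ B * D 0 * pqFib p q g := by gcongr
          _ = _ := by ring
      have h4 : D 0 * D j ≤ c 0 * D 0 * pqFib p q (a.gcd (j * d)) := by
        rw [← hm, hD0]
        calc _ ≤ c j * pqFib p q (a.gcd (j * d)) * D j := by gcongr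
          _ = _ := by ring
      have h5 : D 0 * D j * pqFib p q g ≤ D 0 * D i1 * pqFib p q (a.gcd (j * d)) := by
        calc _ ≤ c 0 * D 0 * pqFib p q (a.gcd (j * d)) * pqFib p q g := by gcongr
          _ = c 0 * D 0 * pqFib p q g * pqFib p q (a.gcd (j * d)) := by ring
          _ ≤ _ := by gcongr
      rw [mul_assoc, mul_assoc] at h5
      have h6 := Nat.le_of_mul_le_mul_left h5 (hD 0)
      rw [mul_comm (D j), mul_comm (D i1)] at h6
      exact absurd hlt' (not_lt.2 h6)
    · have hj1' : (j : ℕ) = 1 := by omega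
      have h3 := (hc j).le_pqLucas hp hpq hd he hj1 (by omega)
      rw [hj1', one_mul] at h1
      have h4 := Nat.mul_le_mul_right (pqFib p q (a.gcd d)) h3
      omega

end FibFamily

/-! ### The extra generator when d ∣ a, and the bounds for the family. -/

section FibFamily

variable {p q : ℕ} {n h a d : ℕ}

/-- Take u = ⌊Q/P⌋ + 1, the least value with uP - Q positive; P ∤ Q by coprimality. -/
theorem exists_quotient_of_coprime {P Q : ℕ} (hP : 3 ≤ P) (hPQ : 4 * Q ≤ P ^ 2)
    (hco : P.Coprime Q) : ∃ u, 1 ≤ u ∧ Q < u * P ∧ (u - 1) * P < Q ∧ 2 * u ≤ P := by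
  have hu2 : Q / P * P < Q := by
    refine lt_of_le_of_ne (Nat.div_mul_le_self Q P) fun h => ?_
    have h1 : P ∣ Q := ⟨Q / P, by rw [mul_comm, h]⟩
    have h3 := hco.eq_one_of_dvd h1
    omega
  refine ⟨Q / P + 1, Nat.le_add_left 1 _, ?_, by simpa using hu2, ?_⟩
  · rw [mul_comm]
    exact Nat.lt_mul_div_succ Q (by omega)
  · have h1 : 4 * (Q / P) < P := by
      refine Nat.lt_of_mul_lt_mul_right (a := P) ?_
      nlinarith
    omega

theorem pqLucas_mul_pqFib_le (p q d : ℕ) {m : ℕ} (hd : 0 < d) (hm : 0 < m) :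
    pqLucas p q d * pqFib p q m ≤ 2 * pqFib p q (m + d) := by
  obtain ⟨m, rfl⟩ : ∃ l, m = l + 1 := ⟨m - 1, by omega⟩
  have h1 := Nat.mul_le_mul_right (pqFib p q (m + 1)) (pqLucas_le (p := p) (q := q) hd)
  have h2 := pqFib_mul_le p q d m
  rw [show m + 1 + d = d + m + 1 by ring]
  nlinarith

theorem pqLucas_mul_pqFib_two (p q h a : ℕ) (hd : 0 < d) (he : Even d) :
    pqLucas p q d * pqFib p q (h * a + 2 * d) =
      pqFib p q (h * a + 3 * d) + q ^ d * pqFib p q (h * a + d) := by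
  have := pqLucas_mul_pqFib_of_even p q (h * a + d) hd he
  rwa [show h * a + d + d = h * a + 2 * d by ring,
    show h * a + d + 2 * d = h * a + 3 * d by ring] at this

theorem exponents_eq_of_pqFib_combination_eq (hp : 0 < p) (hq : 0 < q) (hpq : p.Coprime q)
    (hh : 0 < h) (ha : 0 < a) (hd : 0 < d) (he : Even d) (hda : d ∣ a) (h3 : 3 * d ≤ a)
    {u : ℕ} (hu0 : 1 ≤ u) (hu1 : q ^ d < u * pqLucas p q d)
    (hu2 : (u - 1) * pqLucas p q d < q ^ d) {v y z w : ℕ} (hyz : 0 < y ∨ 0 < z)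
    (heq : v * pqFib p q a + y * pqFib p q (h * a + d) + z * pqFib p q (h * a + 2 * d) +
      w * pqFib p q (h * a + 3 * d) =
        u * q ^ d * pqFib p q (h * a) + pqFib p q (h * a + 3 * d)) :
    v = 0 ∧ y + q ^ d = u * pqLucas p q d ∧ z + u = pqLucas p q d ∧ w = 0 := by
  have hhad : 0 < h * a := Nat.mul_pos hh ha
  have hA0 := pqFib_pos (q := q) hp ha
  have hFd : 0 < pqFib p q d := pqFib_pos hp hd
  have hP3 : 3 ≤ pqLucas p q d := three_le_pqLucas hp hq (Nat.le_of_dvd hd he.two_dvd)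
  have hQ0 : 0 < q ^ d := pow_pos hq d
  have hPQ := four_mul_pow_le_pqLucas_sq p q hd he
  have hPX := pqLucas_mul_pqFib_le p q d hd hhad
  have hN0 : 0 < pqFib p q (h * a) := pqFib_pos hp hhad
  have eqY := pqLucas_mul_pqFib_of_even p q (h * a) hd he
  have eqZ := pqLucas_mul_pqFib_two p q h a hd he
  have hgcdAX : (pqFib p q a).gcd (pqFib p q (h * a + d)) = pqFib p q d := by
    rw [gcd_pqFib_mul_add hpq, Nat.gcd_eq_right hda]
  have hRP : pqLucas p q d ^ 2 * pqFib p q d ≤ pqFib p q a + q ^ d * pqFib p q d := by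
    have h1 := pqLucas_mul_pqFib_of_even p q d hd he
    rw [← two_mul, pqFib_two_mul, show d + 2 * d = 3 * d by ring] at h1
    have h2 : pqFib p q (3 * d) ≤ pqFib p q a := pqFib_mono hp h3
    rw [sq, mul_assoc, h1]
    exact Nat.add_le_add_right h2 _
  have hNdvd := pqFib_dvd hpq (dvd_mul_left a h)
  generalize pqFib p q (h * a + 3 * d) = Z at *
  generalize pqFib p q (h * a + 2 * d) = Y at *
  generalize pqFib p q (h * a + d) = X at *
  generalize pqFib p q (h * a) = N at *
  generalize pqFib p q a = A at *
  generalize pqLucas p q d = P at *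
  generalize pqFib p q d = E at *
  generalize q ^ d = Q at *
  obtain ⟨R, hR⟩ : E ∣ A := hgcdAX ▸ Nat.gcd_dvd_left A X
  obtain ⟨X', hX'⟩ : E ∣ X := hgcdAX ▸ Nat.gcd_dvd_right A X
  obtain ⟨N', hN'⟩ := hNdvd
  have hco : IsCoprime (R : ℤ) X' := by
    rw [Nat.isCoprime_iff_coprime]
    refine Nat.eq_of_mul_eq_mul_left hFd ?_
    rw [← Nat.gcd_mul_left, ← hR, ← hX', hgcdAX, mul_one]
  have hRP' : P ^ 2 ≤ R + Q := by
    refine (Nat.mul_le_mul_left_iff hFd).1 ?_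
    rw [mul_add, ← hR, mul_comm, mul_comm E Q]
    exact hRP
  have hYz : (Y : ℤ) = P * X - Q * N := by
    rw [eq_sub_iff_add_eq]; exact_mod_cast eqY.symm
  have hZz : (Z : ℤ) = (P ^ 2 - Q) * X - P * Q * N := by
    have : (P * Y : ℤ) = Z + Q * X := by exact_mod_cast eqZ
    rw [hYz] at this
    linear_combination -this
  have hmz : (v * A + y * X + z * Y + w * Z : ℤ) = u * Q * N + Z := by exact_mod_cast heq
  rw [hYz, hZz] at hmz
  -- Modulo A the terms in N vanish, leaving a multiple of X; divide by E and use that R and X' are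
  -- coprime.
  have hdvd : (R : ℤ) ∣ y + z * P + w * (P ^ 2 - Q) - (P ^ 2 - Q) := by
    refine hco.dvd_of_dvd_mul_right ?_
    refine Int.dvd_of_mul_dvd_mul_left (a := E) (by exact_mod_cast hFd.ne') ?_
    refine ⟨Q * N' * (z + w * P - P + u) - v, ?_⟩
    have hRz : (A : ℤ) = E * R := by exact_mod_cast hR
    have hXz : (X : ℤ) = E * X' := by exact_mod_cast hX'
    have hNz : (N : ℤ) = A * N' := by exact_mod_cast hN'
    rw [← hRz]
    rw [hXz, hNz] at hmz
    linear_combination hmz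
  obtain ⟨r0, r1, r2, r3⟩ := exponents_eq_of_degree_eq (P := P) (Q := Q) (u := u) (X := X)
    (N := N) (A := A) (R := R) (by exact_mod_cast hP3) (by exact_mod_cast hQ0)
    (by exact_mod_cast hPQ) (by zify [hu0] at hu2; exact hu2) (by exact_mod_cast hu1)
    (by exact_mod_cast hN0) (by exact_mod_cast hPX) (by exact_mod_cast hA0)
    (by rw [sub_le_iff_le_add]; exact_mod_cast hRP') (Nat.cast_nonneg y)
    (Nat.cast_nonneg z) (Nat.cast_nonneg w) (Nat.cast_nonneg v)
    (by linear_combination hmz) hdvd (by exact_mod_cast hyz)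
  refine ⟨by exact_mod_cast r0, ?_, ?_, by exact_mod_cast r3⟩
  · zify; linear_combination r1
  · zify; linear_combination r2

/-- For `d ∣ a` the binomial `x₂ ^ (u P - Q) x₃ ^ (P - u) - x₁ ^ s x₄`, where `P` is the Lucas number
of `d` and `Q = q ^ d`, is an additional minimal generator. -/
theorem le_spanFinrank_fibFamily_of_dvd (k : Type*) [Field k] (hp : 0 < p) (hq : 0 < q)
    (hpq : p.Coprime q) (hh : 0 < h) (ha : 0 < a) (hd : 0 < d) (he : Even d)
    (hda : d ∣ a) (h3 : 3 * d ≤ a) :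
    n + 4 ≤ (toricIdeal k (fibFamily p q (n + 4) h a d)).spanFinrank := by
  obtain ⟨c, hc⟩ := exists_isCritical_fibFamily (q := q) (d := d) hp hh ha (show 2 ≤ n + 4 by omega)
  have hpos {j : Fin (n + 4)} (hj : j ≠ 0) : 0 < (j : ℕ) :=
    Nat.pos_of_ne_zero fun h => hj (Fin.ext h)
  have hne (i j : Fin (n + 4)) (hi : i ≠ 0) (hj : j ≠ 0) (hij : i ≠ j) :=
    critical_mul_ne hp hq hpq hh ha hd he (fun j _ => hc j) (hpos hi) (hpos hj) hij
  have hd2 : 2 ≤ d := Nat.le_of_dvd hd he.two_dvd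
  have hhad : 0 < h * a := Nat.mul_pos hh ha
  have hQ0 : 0 < q ^ d := pow_pos hq d
  obtain ⟨N, hN⟩ := pqFib_dvd hpq (dvd_mul_left a h)
  have hN0 : 0 < N := Nat.pos_of_mul_pos_left (hN ▸ pqFib_pos hp hhad)
  have eqY := pqLucas_mul_pqFib_of_even p q (h * a) hd he
  have eqZ := pqLucas_mul_pqFib_two p q h a hd he
  obtain ⟨u, hu0, hu1, hu2, huP⟩ := exists_quotient_of_coprime (three_le_pqLucas hp hq hd2)
    (four_mul_pow_le_pqLucas_sq p q hd he) ((coprime_pqLucas hpq d).pow_right d)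
  -- The degree of the extra binomial is thus below 2 D 3, which excludes x_4, x_5, … from its
  -- monomials.
  have hZ2 : u * q ^ d * pqFib p q (h * a) < pqFib p q (h * a + 3 * d) := by
    have h1 : 2 * (u * q ^ d * pqFib p q (h * a)) ≤ 2 * (q ^ d * pqFib p q (h * a + d)) := by
      calc 2 * (u * q ^ d * pqFib p q (h * a)) = q ^ d * (2 * u * pqFib p q (h * a)) := by ring
        _ ≤ q ^ d * (pqLucas p q d * pqFib p q (h * a)) := by gcongr
        _ ≤ q ^ d * (2 * pqFib p q (h * a + d)) :=
          Nat.mul_le_mul_left _ (pqLucas_mul_pqFib_le p q d hd hhad)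
        _ = _ := by ring
    have h2 := pow_mul_pqFib_lt hp hq hd (h * a + d)
    rw [show h * a + d + 2 * d = h * a + 3 * d by ring] at h2
    omega
  have hiso {v y z w : ℕ} := exponents_eq_of_pqFib_combination_eq (v := v) (y := y) (z := z)
    (w := w) hp hq hpq hh ha hd he hda h3 hu0 hu1 hu2
  have hD : ∀ i, 0 < fibFamily p q (n + 4) h a d i := fibFamily_pos hp hh ha
  let e1 : Fin (n + 4) := Fin.succ 0
  let e2 : Fin (n + 4) := Fin.succ (Fin.succ 0)
  let e3 : Fin (n + 4) := Fin.succ (Fin.succ (Fin.succ 0))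
  have hD0 : fibFamily p q (n + 4) h a d 0 = pqFib p q a := rfl
  have hD1 : fibFamily p q (n + 4) h a d e1 = pqFib p q (h * a + d) := by
    rw [fibFamily_of_pos (Nat.succ_pos _), show (e1 : ℕ) = 1 from rfl, one_mul]
  have hD2 : fibFamily p q (n + 4) h a d e2 = pqFib p q (h * a + 2 * d) :=
    fibFamily_of_pos (Nat.succ_pos _)
  have hD3 : fibFamily p q (n + 4) h a d e3 = pqFib p q (h * a + 3 * d) :=
    fibFamily_of_pos (Nat.succ_pos _)
  have hlarge (j : Fin n) : 2 * pqFib p q (h * a + 3 * d) ≤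
      fibFamily p q (n + 4) h a d j.succ.succ.succ.succ := by
    refine (two_mul_pqFib_le hp hq _).trans ?_
    rw [fibFamily_of_pos (Nat.succ_pos _)]
    refine pqFib_mono hp ?_
    simp only [Fin.val_succ]
    nlinarith
  generalize fibFamily p q (n + 4) h a d = D at *
  have h01 : (0 : Fin (n + 4)) ≠ e1 := Fin.ne_of_val_ne (Nat.succ_ne_zero 0).symm
  have h02 : (0 : Fin (n + 4)) ≠ e2 := Fin.ne_of_val_ne (Nat.succ_ne_zero 1).symm
  have h03 : (0 : Fin (n + 4)) ≠ e3 := Fin.ne_of_val_ne (Nat.succ_ne_zero 2).symm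
  have h12 : e1 ≠ e2 := Fin.ne_of_val_ne (show 1 ≠ 2 by omega)
  have h13 : e1 ≠ e3 := Fin.ne_of_val_ne (show 1 ≠ 3 by omega)
  have h23 : e2 ≠ e3 := Fin.ne_of_val_ne (show 2 ≠ 3 by omega)
  have hsum (m : Fin (n + 4) →₀ ℕ) : toricDeg D m = m 0 * D 0 + m e1 * D e1 + m e2 * D e2 +
      m e3 * D e3 + ∑ j : Fin n, m j.succ.succ.succ.succ * D j.succ.succ.succ.succ := by
    simp only [toricDeg, Fin.sum_univ_succ, e1, e2, e3]
    ring
  have hext (m m' : Fin (n + 4) →₀ ℕ) (s0 : m 0 = m' 0) (s1 : m e1 = m' e1) (s2 : m e2 = m' e2)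
      (s3 : m e3 = m' e3) (s4 : ∀ j : Fin n, m j.succ.succ.succ.succ = m' j.succ.succ.succ.succ) :
      m = m' := by
    ext j
    exact Fin.cases s0 (fun j => Fin.cases s1 (fun j => Fin.cases s2 (fun j => Fin.cases s3
      s4 j) j) j) j
  have hge (j : Fin n) : j.succ.succ.succ.succ ≠ e1 ∧ j.succ.succ.succ.succ ≠ e2 := by
    constructor <;> refine Fin.ne_of_val_ne ?_
    · change (j : ℕ) + 1 + 1 + 1 + 1 ≠ 1
      omega
    · change (j : ℕ) + 1 + 1 + 1 + 1 ≠ 2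
      omega
  clear_value e1 e2 e3
  set M : Fin (n + 4) →₀ ℕ :=
    Finsupp.single e1 (u * pqLucas p q d - q ^ d) + Finsupp.single e2 (pqLucas p q d - u) with hM
  set M' : Fin (n + 4) →₀ ℕ := Finsupp.single 0 (u * q ^ d * N) + Finsupp.single e3 1 with hM'
  have hM1 : M e1 = u * pqLucas p q d - q ^ d := by simp [hM, h12]
  have hM2 : M e2 = pqLucas p q d - u := by simp [hM, h12.symm]
  have hM3 : M e3 = 0 := by simp [hM, h13.symm, h23.symm]
  have hM0 : M 0 = 0 := by simp [hM, h01, h02]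
  have hM0pos : 0 < M' 0 := by
    have : M' 0 = u * q ^ d * N := by simp [hM', h03]
    rw [this]
    positivity
  have hdeg' : toricDeg D M' = u * q ^ d * pqFib p q (h * a) + pqFib p q (h * a + 3 * d) := by
    rw [toricDeg_add, toricDeg_single, toricDeg_single, hD0, hD3, hN]
    ring
  have huP' : u ≤ pqLucas p q d := by omega
  have hdeg : toricDeg D M = u * q ^ d * pqFib p q (h * a) + pqFib p q (h * a + 3 * d) := by
    rw [toricDeg_add, toricDeg_single, toricDeg_single, hD1, hD2]
    zify [hu1.le, huP'] at eqY eqZ ⊢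
    -- The extra binomial combines u copies of the recurrence at x_1 with one at x_2.
    linear_combination (u : ℤ) * eqY + eqZ
  refine le_spanFinrank_toricIdeal_of_isCritical k hD 0 (M := M) (M' := M') (fun j _ => hc j)
    hne ?_ (hdeg.trans hdeg'.symm) ?_ ?_ ?_
  · intro m hm i hi hMi
    rw [hdeg] at hm
    have hzero (j : Fin n) : m j.succ.succ.succ.succ = 0 := by
      by_contra h0
      have h1 : m j.succ.succ.succ.succ * D j.succ.succ.succ.succ ≤ toricDeg D m :=
        Finset.single_le_sum (f := fun i => m i * D i) (fun _ _ => Nat.zero_le _)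
          (Finset.mem_univ _)
      have h2 := hlarge j
      have h3 := Nat.le_mul_of_pos_left (D j.succ.succ.succ.succ) (Nat.pos_of_ne_zero h0)
      omega
    rw [hsum] at hm
    simp only [hzero, zero_mul, Finset.sum_const_zero, add_zero, hD0, hD1, hD2, hD3] at hm
    have hyz : 0 < m e1 ∨ 0 < m e2 := by
      by_cases h1 : i = e1
      · left; subst h1; exact Nat.pos_of_ne_zero hi
      · by_cases h2 : i = e2
        · right; subst h2; exact Nat.pos_of_ne_zero hi
        · exact absurd (by simp [hM, h1, h2]) hMi
    obtain ⟨r0, r1, r2, r3⟩ := hiso hyz hm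
    refine hext m M (by rw [hM0, r0]) (by rw [hM1]; omega) (by rw [hM2]; omega) (by rw [hM3, r3])
      fun j => ?_
    rw [hzero]
    simp [hM, (hge j).1, (hge j).2]
  · intro h
    rw [h, hM0] at hM0pos
    exact hM0pos.false
  · intro j hj hcon
    have h1 : M e1 ≠ 0 := by omega
    have h2 : M e2 ≠ 0 := by omega
    rw [hcon] at h1 h2
    have h3 : e1 = j := by
      by_contra h
      exact h1 (Finsupp.single_eq_of_ne h)
    have h4 : e2 = j := by
      by_contra h
      exact h2 (Finsupp.single_eq_of_ne h)
    exact h12 (h3.trans h4.symm)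
  · intro j hj hcon
    rw [hcon, Finsupp.single_eq_of_ne hj.symm] at hM0pos
    exact hM0pos.false

theorem le_spanFinrank_fibFamily (k : Type*) [Field k] (hp : 0 < p) (hq : 0 < q)
    (hpq : p.Coprime q) (hh : 0 < h) (hd : 0 < d) (he : Even d) (hda : d < a)
    (h2 : a ≠ 2 * d) (hgcd : ¬ (a.gcd d + d = a ∧ Odd a)) (hn : ¬ (n = 0 ∧ 2 * d ∣ a)) :
    n + 3 ≤ (toricIdeal k (fibFamily p q (n + 3) h a d)).spanFinrank := by
  have ha : 0 < a := by omega
  have hlt := pqLucas_mul_lt hp hq hd he hda h2 hgcd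
  have hg : 0 < a.gcd d := Nat.gcd_pos_of_pos_left _ ha
  rcases Nat.eq_zero_or_pos n with rfl | hn0
  · refine le_spanFinrank_fibFamily_of_gcd_le k hp hq hpq hh ha hd he hlt fun j hj hj' => ?_
    have hj2 : j = 2 := by omega
    subst hj2
    obtain ⟨t, ht⟩ := Nat.gcd_dvd_right a (2 * d)
    have ht1 : t ≠ 1 := by
      rintro rfl
      rw [mul_one] at ht
      exact hn ⟨rfl, ht ▸ Nat.gcd_dvd_left _ _⟩
    have ht0 : t ≠ 0 := by
      rintro rfl
      omega
    have := Nat.mul_le_mul_left (a.gcd (2 * d)) (show 2 ≤ t by omega)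
    omega
  · by_cases hdvd : d ∣ a
    · obtain ⟨n, rfl⟩ : ∃ l, n = l + 1 := ⟨n - 1, by omega⟩
      refine le_spanFinrank_fibFamily_of_dvd k hp hq hpq hh ha hd he hdvd ?_
      obtain ⟨s, rfl⟩ := hdvd
      have hs1 : s ≠ 0 := by rintro rfl; omega
      have hs2 : s ≠ 1 := by rintro rfl; omega
      have hs3 : s ≠ 2 := by rintro rfl; omega
      rw [mul_comm]
      exact Nat.mul_le_mul_left d (by omega)
    · refine le_spanFinrank_fibFamily_of_gcd_le k hp hq hpq hh ha hd he hlt fun j hj _ => ?_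
      -- Since d ∤ a, gcd(a, d) is at most d / 2, so j gcd(a, d) stays below the required bound.
      have h1 : a.gcd (j * d) ≤ j * a.gcd d := by
        refine Nat.le_of_dvd (Nat.mul_pos (by omega) hg) ?_
        exact (Nat.gcd_mul_right_dvd_mul_gcd a j d).trans
          (mul_dvd_mul_right (Nat.gcd_dvd_right _ _) _)
      obtain ⟨t, ht⟩ := Nat.gcd_dvd_right a d
      have ht1 : t ≠ 1 := by
        rintro rfl
        rw [mul_one] at ht
        exact hdvd (ht ▸ Nat.gcd_dvd_left _ _)
      have ht0 : t ≠ 0 := by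
        rintro rfl
        omega
      have h2 := Nat.mul_le_mul_left (a.gcd d) (show 2 ≤ t by omega)
      rw [← ht] at h2
      obtain ⟨i, rfl⟩ : ∃ i, j = i + 2 := ⟨j - 2, by omega⟩
      rw [show i + 2 - 1 = i + 1 by omega]
      nlinarith

theorem spanFinrank_fibFamily_le (k : Type*) [Field k] (hp : 0 < p) (hq : 0 < q)
    (hpq : p.Coprime q) (hh : 0 < h) (ha : 0 < a) (hd : 0 < d)
    (H : Odd d ∨ a ≤ d ∨ a = 2 * d ∨ (a.gcd d + d = a ∧ Odd a)) :
    (toricIdeal k (fibFamily p q (n + 3) h a d)).spanFinrank ≤ n + 2 := by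
  refine spanFinrank_toricIdeal_le_of_mem_closure k (n := n + 1) (fibFamily_pos hp hh ha 0)
    fun i => ?_
  obtain ⟨α, β, hαβ⟩ := exists_pqFib_combination hp hq hpq hh ha hd H
    (show 2 ≤ (i : ℕ) + 2 by omega)
  refine ⟨α, β, ?_⟩
  rw [fibFamily_zero, fibFamily_of_pos (i := 1) (by simp),
    fibFamily_of_pos (i := i.succ.succ) (by simp)]
  simpa [add_assoc] using hαβ

/-- Here gcd(D 0, D 2) = F_{2d} = L F_d, so the exponent of x_1 required for gluing is exactly L. -/
theorem spanFinrank_fibFamily_three_le (k : Type*) [Field k] (hp : 0 < p)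
    (hpq : p.Coprime q) (hh : 0 < h) (ha : 0 < a) (hd : 0 < d) (he : Even d) (hda : 2 * d ∣ a) :
    (toricIdeal k (fibFamily p q 3 h a d)).spanFinrank ≤ 2 := by
  obtain ⟨s, hs⟩ : pqFib p q a ∣ pqFib p q (h * a) := pqFib_dvd hpq (dvd_mul_left a h)
  have h0 : fibFamily p q 3 h a d 0 = pqFib p q a := rfl
  have h1 : fibFamily p q 3 h a d 1 = pqFib p q (h * a + d) := by simp [fibFamily]
  have h2 : fibFamily p q 3 h a d 2 = pqFib p q (h * a + 2 * d) := by simp [fibFamily]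
  refine spanFinrank_toricIdeal_le_two k (P := pqLucas p q d) (v := q ^ d * s)
    (fibFamily_pos hp hh ha 0) ?_ ?_
  · obtain ⟨t, rfl⟩ := hda
    rw [h0, h1, h2, gcd_pqFib_mul_add hpq, Nat.gcd_eq_right (dvd_mul_right _ _),
      show h * (2 * d * t) + d = (h * t) * (2 * d) + d by ring, gcd_pqFib_mul_add hpq,
      Nat.gcd_mul_left_left, pqFib_two_mul, Nat.mul_div_cancel _ (pqFib_pos hp hd)]
  · rw [h0, h1, h2, pqLucas_mul_pqFib_of_even p q _ hd he, hs]
    ring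

end FibFamily

/-! ### The classification. -/

theorem mainTheorem3 (k : Type*) [Field k] (p q : ℕ) (hp : 0 < p) (hq : 0 < q)
    (hpq : Nat.Coprime p q) (n h a d : ℕ) (hn : 3 ≤ n) (hh : 0 < h) (ha : 0 < a) (hd : 0 < d) :
    IsCompleteIntersectionIdeal (toricIdeal k (fibFamily p q n h a d)) ↔
      Odd d ∨ a ≤ d ∨ a = 2 * d ∨ ((Nat.gcd a d : ℤ) = (a : ℤ) - (d : ℤ) ∧ Odd a) ∨
        (n = 3 ∧ 2 * d ∣ a) := by
  obtain ⟨n, rfl⟩ : ∃ l, n = l + 3 := ⟨n - 3, by omega⟩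
  rw [isCompleteIntersectionIdeal_toricIdeal_iff k (n := n + 2) (fibFamily_pos hp hh ha),
    show n + 2 + 1 = n + 3 from rfl,
    show (Nat.gcd a d : ℤ) = (a : ℤ) - (d : ℤ) ↔ a.gcd d + d = a by omega]
  constructor
  · intro H
    by_contra hcon
    simp only [not_or, Nat.not_odd_iff_even, not_le] at hcon
    obtain ⟨he, hda, h2, hgcd, h3⟩ := hcon
    have := le_spanFinrank_fibFamily (n := n) k hp hq hpq hh hd he hda h2 hgcd
      fun h => h3 ⟨by omega, h.2⟩
    omega
  · intro H
    by_cases ho : Odd d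
    · exact spanFinrank_fibFamily_le k hp hq hpq hh ha hd (Or.inl ho)
    rcases H with H | H | H | H | ⟨hn3, H⟩
    · exact absurd H ho
    · exact spanFinrank_fibFamily_le k hp hq hpq hh ha hd (Or.inr (Or.inl H))
    · exact spanFinrank_fibFamily_le k hp hq hpq hh ha hd (Or.inr (Or.inr (Or.inl H)))
    · exact spanFinrank_fibFamily_le k hp hq hpq hh ha hd (Or.inr (Or.inr (Or.inr H)))
    · obtain rfl : n = 0 := by omega
      exact spanFinrank_fibFamily_three_le k hp hpq hh ha hd (Nat.not_odd_iff_even.1 ho) H
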